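/- Let $\mathcal N$ be a smooth $m$-dimensional (Hausdorff) manifold. Metric hypersurface data on $\mathcal N$ consist of a smooth symmetric two-covariant tensor $\gamma$, a smooth one-form $\boldsymbol\ell$ and a smooth function $\ell^{(2)}$ such that at each $x\in\mathcal N$ the symmetric bilinear form $$\mathcal A|_x\big((W,a),(Z,b)\big)=\gamma(W,Z)+a\,\boldsymbol\ell(Z)+b\,\boldsymbol\ell(W)+ab\,\ell^{(2)}$$ on $T_x\mathcal N\times\mathbb R$ is non-degenerate. Let $n$ (a vector field) and $n^{(2)}$ (a function) be determined by $\mathcal A\big((n,n^{(2)}),(Z,b)\big)=b$ for all $(Z,b)$, i.e. they are the components $\mathcal A^\sharp((0,1),(\cdot,0))$ and $\mathcal A^\sharp((0,1),(0,1))$ of the inverse tensor $\mathcal A^\sharp$. Put $$U=\tfrac12\mathcal L_n\gamma+\tfrac12\big(\boldsymbol\ell\otimes dn^{(2)}+dn^{(2)}\otimes\boldsymbol\ell\big),\qquad F=\tfrac12\,d\boldsymbol\ell .$$ The metric hypersurface connection $\overset{\circ}{\nabla}$ is the torsion-free connection on $\mathcal N$ such that, for all vector fields $X,Z,W$, $$(\overset{\circ}{\nabla}_X\gamma)(Z,W)=-U(X,Z)\boldsymbol\ell(W)-U(X,W)\boldsymbol\ell(Z),\qquad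 (\overset{\circ}{\nabla}_X\boldsymbol\ell)(Z)+(\overset{\circ}{\nabla}_Z\boldsymbol\ell)(X)=-2\ell^{(2)}U(X,Z).$$ A point $x$ is non-null if $\gamma|_x$ is non-degenerate. The curvature of a connection $\nabla$ is $R(X,Y)Z=\nabla_X\nabla_YZ-\nabla_Y\nabla_XZ-\nabla_{[X,Y]}Z$, and $R^a{}_{bcd}\,\alpha_aZ^bX^cY^d=\alpha(R(X,Y)Z)$. Let $p\in\mathcal N$ and let $U_p$ be an open neighbourhood of $p$ consisting of non-null points. On $U_p$, let $\gamma^\sharp$ be the inverse of $\gamma$, raise and lower indices with $\gamma^\sharp$ and $\gamma$, and let $\nabla^{(\gamma)}$ be the Levi-Civita connection of $\gamma$, $R^{(\gamma)}$ its curvature tensor, $\ell^\sharp=\gamma^\sharp(\boldsymbol\ell,\cdot)$, $\ell\cdot\ell=\gamma(\ell^\sharp,\ell^\sharp)$, $\mathfrak a=\nabla^{(\gamma)}_{\ell^\sharp}\ell^\sharp$, $f=-\dfrac{1}{2(\ell^{(2)}-\ell\cdot\ell)}$ and $\Pi=\mathcal L_{\ell^\sharp}\gamma$. Then the connections $\overset{\circ}{\nabla}$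 (on $\mathcal N$) and $\nabla^{(\gamma)}$ (on $U_p$) exist, and on $U_p$ one has $\ell^{(2)}-\ell\cdot\ell\neq0$ (so that $f$ is well defined), $\Pi_{ab}=\nabla^{(\gamma)}_a\ell_b+\nabla^{(\gamma)}_b\ell_a$, and the curvature tensor $\overset{\circ}{R}$ of $\overset{\circ}{\nabla}$ satisfies $$\begin{aligned}\overset{\circ}{R}{}^a{}_{bcd}=R^{(\gamma)a}{}_{bcd}&+\ell^a\Big(f\nabla^{(\gamma)}_c\Pi_{bd}+\Pi_{bd}\big(\nabla^{(\gamma)}_cf+\tfrac12f^2\nabla^{(\gamma)}_c(\ell\cdot\ell)+f^2\mathfrak a_c\big)\\&\qquad-f\nabla^{(\gamma)}_d\Pi_{bc}-\Pi_{bc}\big(\nabla^{(\gamma)}_df+\tfrac12f^2\nabla^{(\gamma)}_d(\ell\cdot\ell)+f^2\mathfrak a_d\big)\Big)\\&+\frac f2\big(\Pi^a{}_c\Pi_{bd}-\Pi^a{}_d\Pi_{bc}\big)+f\big(F^a{}_d\Pi_{bc}-F^a{}_c\Pi_{bd}\big).\end{aligned}$$ -/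

import Mathlib

open Bundle Set
open scoped Manifold ContDiff

noncomputable section

namespace HypersurfaceData

section Fields

variable (m : ℕ) (N : Type*) [TopologicalSpace N] [ChartedSpace (EuclideanSpace ℝ (Fin m)) N]

/-- Vector fields on `N` (with no regularity imposed). -/
abbrev VecField := Π x : N, TangentSpace (𝓡 m) x

/-- One-form fields on `N` (with no regularity imposed). -/
abbrev OneForm := Π x : N, TangentSpace (𝓡 m) x →L[ℝ] ℝ

/-- Two-covariant tensor fields on `N` (with no regularity imposed). -/
abbrev TwoTensor := Π x : N, TangentSpace (𝓡 m) x →L[ℝ] TangentSpace (𝓡 m) x →L[ℝ] ℝ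

/-- The underlying function of an affine connection, with Mathlib's argument order:
`nabla Z x (X x)` is `(∇_X Z)(x)`. -/
abbrev ConnMap := (Π x : N, TangentSpace (𝓡 m) x) →
  (Π x : N, TangentSpace (𝓡 m) x →L[ℝ] TangentSpace (𝓡 m) x)

end Fields

section Calculus

variable {m : ℕ} {N : Type*} [TopologicalSpace N] [ChartedSpace (EuclideanSpace ℝ (Fin m)) N]

/-- The vector field `X` is smooth on the set `S`. -/
def SmoothVecOn [IsManifold (𝓡 m) ∞ N] (X : VecField m N) (S : Set N) : Prop :=
  ContMDiffOn (𝓡 m) ((𝓡 m).prod 𝓘(ℝ, EuclideanSpace ℝ (Fin m))) ∞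
    (fun x ↦ TotalSpace.mk' (EuclideanSpace ℝ (Fin m)) x (X x)) S

/-- The vector field `X` is differentiable at the point `x`. -/
def DiffVecAt [IsManifold (𝓡 m) ∞ N] (X : VecField m N) (x : N) : Prop :=
  MDifferentiableAt (𝓡 m) ((𝓡 m).prod 𝓘(ℝ, EuclideanSpace ℝ (Fin m)))
    (fun y ↦ TotalSpace.mk' (EuclideanSpace ℝ (Fin m)) y (X y)) x

/-- The one-form `α` is smooth on the set `S`. -/
def SmoothFormOn [IsManifold (𝓡 m) ∞ N] (α : OneForm m N) (S : Set N) : Prop :=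
  ContMDiffOn (𝓡 m) ((𝓡 m).prod 𝓘(ℝ, EuclideanSpace ℝ (Fin m) →L[ℝ] ℝ)) ∞
    (fun x ↦ TotalSpace.mk' (EuclideanSpace ℝ (Fin m) →L[ℝ] ℝ) x (α x)) S

/-- The two-covariant tensor `T` is smooth on the set `S`. -/
def SmoothTwoTensorOn [IsManifold (𝓡 m) ∞ N] (T : TwoTensor m N) (S : Set N) : Prop :=
  ContMDiffOn (𝓡 m)
    ((𝓡 m).prod 𝓘(ℝ, EuclideanSpace ℝ (Fin m) →L[ℝ] EuclideanSpace ℝ (Fin m) →L[ℝ] ℝ)) ∞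
    (fun x ↦ TotalSpace.mk'
      (EuclideanSpace ℝ (Fin m) →L[ℝ] EuclideanSpace ℝ (Fin m) →L[ℝ] ℝ) x (T x)) S

/-- The derivative `X(g)` of the scalar field `g` along the vector field `X`. -/
def dirDeriv (X : VecField m N) (g : N → ℝ) (x : N) : ℝ := mvfderiv (𝓡 m) g x (X x)

/-- The Lie bracket `[X, Y]`. -/
def bracket (X Y : VecField m N) : VecField m N := VectorField.mlieBracket (𝓡 m) X Y

/-- The Lie derivative of a two-covariant tensor,
`(𝓛_V T)(X, Y) = V(T(X, Y)) - T([V, X], Y) - T(X, [V, Y])`. -/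
def lieDeriv (V : VecField m N) (T : TwoTensor m N) (X Y : VecField m N) (x : N) : ℝ :=
  dirDeriv V (fun y ↦ T y (X y) (Y y)) x - T x (bracket V X x) (Y x) - T x (X x) (bracket V Y x)

/-- The exterior derivative of a one-form, `dα(X, Y) = X(α(Y)) - Y(α(X)) - α([X, Y])`. -/
def extDerivForm (α : OneForm m N) (X Y : VecField m N) (x : N) : ℝ :=
  dirDeriv X (fun y ↦ α y (Y y)) x - dirDeriv Y (fun y ↦ α y (X y)) x - α x (bracket X Y x)

/-- The vector field `∇_X Z`. -/
def covVec (nabla : ConnMap m N) (X Z : VecField m N) : VecField m N := fun x ↦ nabla Z x (X x)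

/-- `(∇_X α)(Z) = X(α(Z)) - α(∇_X Z)` for a one-form `α`. -/
def covForm (nabla : ConnMap m N) (α : OneForm m N) (X Z : VecField m N) (x : N) : ℝ :=
  dirDeriv X (fun y ↦ α y (Z y)) x - α x (covVec nabla X Z x)

/-- `(∇_X T)(Z, W) = X(T(Z, W)) - T(∇_X Z, W) - T(Z, ∇_X W)` for a two-covariant tensor `T`,
given through its values on vector fields. -/
def covTwo (nabla : ConnMap m N) (T : VecField m N → VecField m N → N → ℝ)
    (X Z W : VecField m N) (x : N) : ℝ :=
  dirDeriv X (T Z W) x - T (covVec nabla X Z) W x - T Z (covVec nabla X W) x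

/-- The curvature operator
`R(X, Y) Z = ∇_X ∇_Y Z - ∇_Y ∇_X Z - ∇_{[X, Y]} Z`. -/
def curvature (nabla : ConnMap m N) (X Y Z : VecField m N) : VecField m N := fun x ↦
  covVec nabla X (covVec nabla Y Z) x - covVec nabla Y (covVec nabla X Z) x
    - covVec nabla (bracket X Y) Z x

/-- The curvature tensor `Riem(α, Z, X, Y) = α(R(X, Y) Z)`, in index notation `R^a_{bcd}`
contracted with `α_a Z^b X^c Y^d`. -/
def riem (nabla : ConnMap m N) (α : OneForm m N) (Z X Y : VecField m N) (x : N) : ℝ :=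
  α x (curvature nabla X Y Z x)

/-- `nabla` is a smooth torsion-free affine connection on the set `S`
(which is meant to be open). -/
structure IsTorsionFreeConnectionOn [IsManifold (𝓡 m) ∞ N] (nabla : ConnMap m N) (S : Set N) :
    Prop where
  isCovariantDerivativeOn : IsCovariantDerivativeOn (EuclideanSpace ℝ (Fin m)) nabla S
  smooth : letI : IsManifold (𝓡 m) 1 N := IsManifold.of_le (n := ∞) (by norm_num)
    ContMDiffCovariantDerivativeOn (EuclideanSpace ℝ (Fin m)) ∞ nabla S
  torsionFree : ∀ x ∈ S, ∀ X Y : VecField m N, DiffVecAt X x → DiffVecAt Y x →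
    covVec nabla X Y x - covVec nabla Y X x = bracket X Y x

/-- `nabla` is a Levi-Civita connection of `γ` on the set `S`: torsion-free and `∇γ = 0`. -/
structure IsLeviCivitaOn [IsManifold (𝓡 m) ∞ N] (γ : TwoTensor m N) (nabla : ConnMap m N)
    (S : Set N) : Prop extends IsTorsionFreeConnectionOn nabla S where
  metric : ∀ x ∈ S, ∀ X Z W : VecField m N, DiffVecAt X x → DiffVecAt Z x → DiffVecAt W x →
    covTwo nabla (fun Z W y ↦ γ y (Z y) (W y)) X Z W x = 0

end Calculus

/-- The bilinear form `((W, a), (Z, b)) ↦ γ(W, Z) + a ℓ(Z) + b ℓ(W) + a b ℓ₂` on `V × ℝ`. -/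
def ambientForm {V : Type*} [AddCommGroup V] [Module ℝ V]
    (g : LinearMap.BilinForm ℝ V) (l : V →ₗ[ℝ] ℝ) (l2 : ℝ) : LinearMap.BilinForm ℝ (V × ℝ) :=
  LinearMap.mk₂ ℝ (fun p q ↦ g p.1 q.1 + p.2 * l q.1 + q.2 * l p.1 + p.2 * q.2 * l2)
    (by intros; simp; ring) (by intros; simp; ring)
    (by intros; simp; ring) (by intros; simp; ring)

/-- Metric hypersurface data `{N, γ, ℓ, ℓ⁽²⁾}` on the smooth `m`-dimensional manifold `N`. -/
structure MetricHypersurfaceData (m : ℕ) (N : Type*) [TopologicalSpace N]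
    [ChartedSpace (EuclideanSpace ℝ (Fin m)) N] [IsManifold (𝓡 m) ∞ N] where
  /-- The symmetric two-covariant tensor `γ`. -/
  γ : TwoTensor m N
  /-- The one-form `ℓ`. -/
  ell : OneForm m N
  /-- The scalar `ℓ⁽²⁾`. -/
  ell2 : N → ℝ
  γ_symm : ∀ x (v w : TangentSpace (𝓡 m) x), γ x v w = γ x w v
  γ_smooth : SmoothTwoTensorOn γ univ
  ell_smooth : SmoothFormOn ell univ
  ell2_smooth : ContMDiff (𝓡 m) 𝓘(ℝ, ℝ) ∞ ell2
  nondegenerate : ∀ x, (ambientForm (γ x).toBilinForm (ell x).toLinearMap (ell2 x)).Nondegenerate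

namespace MetricHypersurfaceData

variable {m : ℕ} {N : Type*} [TopologicalSpace N] [ChartedSpace (EuclideanSpace ℝ (Fin m)) N]
  [IsManifold (𝓡 m) ∞ N] (D : MetricHypersurfaceData m N)

instance tangentFinite (x : N) : FiniteDimensional ℝ (TangentSpace (𝓡 m) x) :=
  inferInstanceAs (FiniteDimensional ℝ (EuclideanSpace ℝ (Fin m)))

/-- The tensor `𝒜` at `x`, a bilinear form on `T_x N × ℝ`. -/
def ambient (x : N) : LinearMap.BilinForm ℝ (TangentSpace (𝓡 m) x × ℝ) :=
  ambientForm (D.γ x).toBilinForm (D.ell x).toLinearMap (D.ell2 x)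

/-- The map `(T_x N × ℝ)* → T_x N × ℝ` given by the inverse tensor `𝒜♯`: the covector
`𝒜(V, ·)` is sent to `V`. -/
def ambientSharp (x : N) :
    Module.Dual ℝ (TangentSpace (𝓡 m) x × ℝ) ≃ₗ[ℝ] (TangentSpace (𝓡 m) x × ℝ) :=
  ((D.ambient x).toDual (D.nondegenerate x)).symm

/-- The vector field `n`, determined by `𝒜♯((0, 1), (β, 0)) = β(n)`. -/
def n : VecField m N := fun x ↦ (D.ambientSharp x (LinearMap.snd ℝ _ ℝ)).1

/-- The scalar field `n⁽²⁾ = 𝒜♯((0, 1), (0, 1))`. -/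
def n2 (x : N) : ℝ := (D.ambientSharp x (LinearMap.snd ℝ _ ℝ)).2

/-- `U = (1/2) 𝓛_n γ + ℓ ⊗ₛ dn⁽²⁾`, where `α ⊗ₛ β = (1/2) (α ⊗ β + β ⊗ α)`. -/
def U (X Y : VecField m N) (x : N) : ℝ :=
  (1 / 2) * lieDeriv D.n D.γ X Y x
    + (1 / 2) * (D.ell x (X x) * dirDeriv Y D.n2 x + dirDeriv X D.n2 x * D.ell x (Y x))

/-- `F = (1/2) dℓ`. -/
def F (X Y : VecField m N) (x : N) : ℝ := (1 / 2) * extDerivForm D.ell X Y x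

/-- `nabla` is the metric hypersurface connection of the data: it is torsion-free and
`(∇_X γ)(Z, W) = -U(X, Z) ℓ(W) - U(X, W) ℓ(Z)`,
`(∇_X ℓ)(Z) + (∇_Z ℓ)(X) = -2 ℓ⁽²⁾ U(X, Z)`. -/
structure IsMetricHypersurfaceConnection (nabla : ConnMap m N) : Prop
    extends IsTorsionFreeConnectionOn nabla univ where
  deriv_γ : ∀ x, ∀ X Z W : VecField m N, DiffVecAt X x → DiffVecAt Z x → DiffVecAt W x →
    covTwo nabla (fun Z W y ↦ D.γ y (Z y) (W y)) X Z W x =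
      - D.U X Z x * D.ell x (W x) - D.U X W x * D.ell x (Z x)
  deriv_ell : ∀ x, ∀ X Z : VecField m N, DiffVecAt X x → DiffVecAt Z x →
    covForm nabla D.ell X Z x + covForm nabla D.ell Z X x = - 2 * D.ell2 x * D.U X Z x

/-- `x` is a non-null point: the radical of `γ` at `x` is zero. -/
def IsNonNull (x : N) : Prop :=
  ∀ v : TangentSpace (𝓡 m) x, (∀ w : TangentSpace (𝓡 m) x, D.γ x v w = 0) → v = 0

/-- At a non-null point, `γ` is a nondegenerate bilinear form. -/
theorem IsNonNull.nondegenerate {D : MetricHypersurfaceData m N} {x : N} (h : D.IsNonNull x) :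
    ((D.γ x).toBilinForm).Nondegenerate := by
  refine ⟨fun v hv ↦ h v hv, fun v hv ↦ h v fun w ↦ ?_⟩
  rw [D.γ_symm]
  exact hv w

open Classical in
/-- Index raising with the contravariant metric `γ♯`: at a non-null point, `sharp x α` is the
vector `γ♯(α, ·)`, that is the unique vector `v` with `γ(v, ·) = α`
(and the zero vector, by convention, at null points). -/
def sharp (α : OneForm m N) : VecField m N := fun x ↦
  if h : D.IsNonNull x then
    (((D.γ x).toBilinForm).toDual h.nondegenerate).symm (α x).toLinearMap
  else 0

/-- The vector field `ℓ♯ = γ♯(ℓ, ·)` (on the set of non-null points). -/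
def ellSharp : VecField m N := D.sharp D.ell

/-- `ℓ · ℓ = γ(ℓ♯, ℓ♯)`. -/
def ellDotEll (x : N) : ℝ := D.γ x (D.ellSharp x) (D.ellSharp x)

/-- `f = -1 / (2 (ℓ⁽²⁾ - ℓ · ℓ))`. -/
def f (x : N) : ℝ := - 1 / (2 * (D.ell2 x - D.ellDotEll x))

/-- The deformation tensor `Π = 𝓛_{ℓ♯} γ`. -/
def deformation (X Y : VecField m N) (x : N) : ℝ := lieDeriv D.ellSharp D.γ X Y x

/-- The one-form `𝔞_c = γ(𝔞, ·)` obtained from the acceleration `𝔞 = ∇_{ℓ♯} ℓ♯`. -/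
def accelForm (nabla : ConnMap m N) (X : VecField m N) (x : N) : ℝ :=
  D.γ x (covVec nabla D.ellSharp D.ellSharp x) (X x)

end MetricHypersurfaceData

end HypersurfaceData

end

/-! Both connections come from one construction. For vector fields `X`, `Z` seek a vector `∇_X Z`
and a scalar `c` with `γ(∇_X Z, W) + c ℓ(W) = koszul γ X Z W` for all `W`, and `ℓ(∇_X Z) + c ℓ⁽²⁾ =
koszulForm ell X Z`. The matrix of this system is that of `𝒜`, so the solution exists, is unique
and, by Cramer's rule, is smooth. The parts of the two Koszul expressions that are symmetric or
antisymmetric under swapping arguments encode the derivatives of `γ` and `ℓ` and the vanishing of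
torsion. Testing the system against `W = n` gives `c = -U(X, Z)` (`koszulPair_snd`), which turns
these identities into the defining equations of the metric hypersurface connection. Replacing `(ℓ,
ℓ⁽²⁾)` by `(0, 1)` at non-null points gives the Levi-Civita connection.

At non-null points the two connections differ by `U ⊗ ℓ♯` (`nablaO_eq_add_U`): the remainder is a
three-tensor symmetric in one pair of slots and antisymmetric in an overlapping pair, hence zero.
Inserting this into the equation for `ℓ` gives `Π = -2 (ℓ⁽²⁾ - ℓ·ℓ) U`, that is `U = f Π` (`U_eq`).
The curvature of `∇ + f Π ⊗ ℓ♯` is then expanded (`covVec_nablaO_covVec_nablaO`, `riem_eq`). The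
stated form follows from `Π(X, ℓ♯) = ½ X(ℓ·ℓ) + 𝔞(X)` and from splitting `γ(∇_X ℓ♯, A)` into its
symmetric part `½ Π(A, X)` and antisymmetric part `-F(A, X)`. -/

namespace HypersurfaceData

/-! ### Directional derivatives, Lie brackets and pointwise regularity of tensor fields. -/

section Calculus

variable {m : ℕ} {N : Type*} [TopologicalSpace N] [ChartedSpace (EuclideanSpace ℝ (Fin m)) N]

lemma bracket_swap {X Y : VecField m N} {x : N} : bracket X Y x = - bracket Y X x :=
  VectorField.mlieBracket_swap_apply

section DirDeriv

variable {X Y : VecField m N} {g h : N → ℝ} {x : N}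

lemma dirDeriv_add (hg : MDifferentiableAt (𝓡 m) 𝓘(ℝ, ℝ) g x)
    (hh : MDifferentiableAt (𝓡 m) 𝓘(ℝ, ℝ) h x) :
    dirDeriv X (fun y ↦ g y + h y) x = dirDeriv X g x + dirDeriv X h x := by
  simp [dirDeriv, mvfderiv_fun_add hg hh]

lemma dirDeriv_mul (hg : MDifferentiableAt (𝓡 m) 𝓘(ℝ, ℝ) g x)
    (hh : MDifferentiableAt (𝓡 m) 𝓘(ℝ, ℝ) h x) :
    dirDeriv X (fun y ↦ g y * h y) x = g x * dirDeriv X h x + dirDeriv X g x * h x := by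
  simp [dirDeriv, mvfderiv_fun_mul hg hh]
  ring

lemma dirDeriv_neg : dirDeriv X (fun y ↦ -g y) x = -dirDeriv X g x := by
  simp [dirDeriv, mvfderiv_fun_neg]

lemma dirDeriv_congr (hgh : g =ᶠ[nhds x] h) : dirDeriv X g x = dirDeriv X h x := by
  simp only [dirDeriv, mvfderiv, hgh.mfderiv_eq]
  rfl

@[simp] lemma dirDeriv_add_left : dirDeriv (X + Y) g x = dirDeriv X g x + dirDeriv Y g x := by
  simp [dirDeriv]

@[simp] lemma dirDeriv_smul_left : dirDeriv (h • X) g x = h x * dirDeriv X g x := by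
  simp [dirDeriv]

end DirDeriv

variable [IsManifold (𝓡 m) ∞ N] {X Y Z W : VecField m N} {α : OneForm m N} {T : TwoTensor m N}
  {g : N → ℝ} {x : N} {S : Set N}

instance isManifold_minSmoothness_two : IsManifold (𝓡 m) (minSmoothness ℝ 2) N :=
  IsManifold.of_le (n := ∞) (by simp; norm_cast)

instance isManifold_top_add_one : IsManifold (𝓡 m) ((⊤ : ℕ∞) + 1) N :=
  IsManifold.of_le (n := ∞) (by simp)

lemma bracket_add_left (hX : DiffVecAt X x) (hY : DiffVecAt Y x) :
    bracket (X + Y) Z x = bracket X Z x + bracket Y Z x := VectorField.mlieBracket_add_left hX hY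

lemma bracket_add_right (hX : DiffVecAt X x) (hY : DiffVecAt Y x) :
    bracket Z (X + Y) x = bracket Z X x + bracket Z Y x := VectorField.mlieBracket_add_right hX hY

lemma bracket_smul_left (hg : MDifferentiableAt (𝓡 m) 𝓘(ℝ, ℝ) g x) (hX : DiffVecAt X x) :
    bracket (g • X) Y x = -dirDeriv Y g x • X x + g x • bracket X Y x :=
  VectorField.mlieBracket_smul_left hg hX

lemma bracket_smul_right (hg : MDifferentiableAt (𝓡 m) 𝓘(ℝ, ℝ) g x) (hY : DiffVecAt Y x) :
    bracket X (g • Y) x = dirDeriv X g x • Y x + g x • bracket X Y x :=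
  VectorField.mlieBracket_smul_right hg hY

lemma DiffVecAt.add (hX : DiffVecAt X x) (hY : DiffVecAt Y x) : DiffVecAt (X + Y) x :=
  mdifferentiableAt_add_section hX hY

lemma DiffVecAt.smul (hg : MDifferentiableAt (𝓡 m) 𝓘(ℝ, ℝ) g x) (hX : DiffVecAt X x) :
    DiffVecAt (g • X) x :=
  hg.smul_section hX

lemma DiffVecAt.congr (hX : DiffVecAt X x) (h : ∀ᶠ y in nhds x, Y y = X y) : DiffVecAt Y x :=
  MDifferentiableAt.congr_of_eventuallyEq hX (h.mono fun y hy ↦ by simp [hy])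

lemma exists_diffVecAt (v : TangentSpace (𝓡 m) x) : ∃ V : VecField m N, DiffVecAt V x ∧ V x = v :=
  ⟨FiberBundle.extend (EuclideanSpace ℝ (Fin m)) v,
    FiberBundle.mdifferentiableAt_extend (𝓡 m) (EuclideanSpace ℝ (Fin m)) v, by simp⟩

/-- The vector field `X` is smooth at the point `x`. -/
def SmoothVecAt (X : VecField m N) (x : N) : Prop :=
  ContMDiffAt (𝓡 m) ((𝓡 m).prod 𝓘(ℝ, EuclideanSpace ℝ (Fin m))) ∞
    (fun x ↦ TotalSpace.mk' (EuclideanSpace ℝ (Fin m)) x (X x)) x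

/-- The one-form `α` is smooth at the point `x`. -/
def SmoothFormAt (α : OneForm m N) (x : N) : Prop :=
  ContMDiffAt (𝓡 m) ((𝓡 m).prod 𝓘(ℝ, EuclideanSpace ℝ (Fin m) →L[ℝ] ℝ)) ∞
    (fun x ↦ TotalSpace.mk' (EuclideanSpace ℝ (Fin m) →L[ℝ] ℝ) x (α x)) x

/-- The two-covariant tensor `T` is smooth at the point `x`. -/
def SmoothTwoTensorAt (T : TwoTensor m N) (x : N) : Prop :=
  ContMDiffAt (𝓡 m)
    ((𝓡 m).prod 𝓘(ℝ, EuclideanSpace ℝ (Fin m) →L[ℝ] EuclideanSpace ℝ (Fin m) →L[ℝ] ℝ)) ∞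
    (fun x ↦ TotalSpace.mk'
      (EuclideanSpace ℝ (Fin m) →L[ℝ] EuclideanSpace ℝ (Fin m) →L[ℝ] ℝ) x (T x)) x

lemma SmoothVecOn.smoothVecAt (h : SmoothVecOn X S) (hS : IsOpen S) (hx : x ∈ S) :
    SmoothVecAt X x :=
  ContMDiffOn.contMDiffAt h (hS.mem_nhds hx)

lemma SmoothFormOn.smoothFormAt (h : SmoothFormOn α S) (hS : IsOpen S) (hx : x ∈ S) :
    SmoothFormAt α x :=
  ContMDiffOn.contMDiffAt h (hS.mem_nhds hx)

lemma SmoothTwoTensorOn.smoothTwoTensorAt (h : SmoothTwoTensorOn T S) (hS : IsOpen S)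
    (hx : x ∈ S) : SmoothTwoTensorAt T x :=
  ContMDiffOn.contMDiffAt h (hS.mem_nhds hx)

lemma SmoothVecAt.diffVecAt (h : SmoothVecAt X x) : DiffVecAt X x :=
  ContMDiffAt.mdifferentiableAt h (by simp)

lemma SmoothVecAt.eventually_diffVecAt (h : SmoothVecAt X x) : ∀ᶠ y in nhds x, DiffVecAt X y :=
  ((contMDiffAt_iff_contMDiffAt_nhds (n := 1) (by simp)).mp (ContMDiffAt.of_le h (by simp))).mono
    fun _ hy ↦ hy.mdifferentiableAt (by simp)

lemma SmoothFormAt.apply (h : SmoothFormAt α x) (hX : SmoothVecAt X x) :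
    ContMDiffAt (𝓡 m) 𝓘(ℝ, ℝ) ∞ (fun y ↦ α y (X y)) x := by
  -- The scalar is viewed as a section of the trivial line bundle, where evaluation is a bundle
  -- operation.
  have h1 : ContMDiffAt (𝓡 m) ((𝓡 m).prod 𝓘(ℝ, ℝ)) ∞
    (fun y ↦ TotalSpace.mk' ℝ (E := Bundle.Trivial N ℝ) y (α y (X y))) x :=
    ContMDiffAt.clm_bundle_apply (E₂ := Bundle.Trivial N ℝ) h hX
  rw [contMDiffAt_totalSpace] at h1
  exact h1.2

lemma SmoothFormAt.mdifferentiableAt_apply (h : SmoothFormAt α x) (hX : DiffVecAt X x) :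
    MDifferentiableAt (𝓡 m) 𝓘(ℝ, ℝ) (fun y ↦ α y (X y)) x := by
  have h1 : MDifferentiableAt (𝓡 m) ((𝓡 m).prod 𝓘(ℝ, ℝ))
    (fun y ↦ TotalSpace.mk' ℝ (E := Bundle.Trivial N ℝ) y (α y (X y))) x :=
    MDifferentiableAt.clm_bundle_apply (E₂ := Bundle.Trivial N ℝ)
      (ContMDiffAt.mdifferentiableAt h (by simp)) hX
  rw [mdifferentiableAt_totalSpace] at h1
  exact h1.2

lemma SmoothTwoTensorAt.apply (h : SmoothTwoTensorAt T x) (hX : SmoothVecAt X x)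
    (hY : SmoothVecAt Y x) :
    ContMDiffAt (𝓡 m) 𝓘(ℝ, ℝ) ∞ (fun y ↦ T y (X y) (Y y)) x := by
  have h1 : ContMDiffAt (𝓡 m) ((𝓡 m).prod 𝓘(ℝ, ℝ)) ∞
    (fun y ↦ TotalSpace.mk' ℝ (E := Bundle.Trivial N ℝ) y (T y (X y) (Y y))) x :=
    ContMDiffAt.clm_bundle_apply₂ (E₃ := Bundle.Trivial N ℝ) h hX hY
  rw [contMDiffAt_totalSpace] at h1
  exact h1.2

lemma SmoothTwoTensorAt.mdifferentiableAt_apply (h : SmoothTwoTensorAt T x) (hX : DiffVecAt X x)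
    (hY : DiffVecAt Y x) :
    MDifferentiableAt (𝓡 m) 𝓘(ℝ, ℝ) (fun y ↦ T y (X y) (Y y)) x := by
  have h1 : MDifferentiableAt (𝓡 m) ((𝓡 m).prod 𝓘(ℝ, ℝ))
    (fun y ↦ TotalSpace.mk' ℝ (E := Bundle.Trivial N ℝ) y (T y (X y) (Y y))) x :=
    MDifferentiableAt.clm_bundle_apply₂ (E₃ := Bundle.Trivial N ℝ)
      (ContMDiffAt.mdifferentiableAt h (by simp)) hX hY
  rw [mdifferentiableAt_totalSpace] at h1
  exact h1.2

lemma SmoothVecAt.bracket (hX : SmoothVecAt X x) (hY : SmoothVecAt Y x) :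
    SmoothVecAt (bracket X Y) x :=
  ContMDiffAt.mlieBracket_vectorField (m := ⊤) (n := ⊤) hX hY (by simp)

lemma SmoothVecAt.dirDeriv (hX : SmoothVecAt X x) (hg : ContMDiffAt (𝓡 m) 𝓘(ℝ, ℝ) ∞ g x) :
    ContMDiffAt (𝓡 m) 𝓘(ℝ, ℝ) ∞ (dirDeriv X g) x := by
  have h1 := ContMDiffAt.clm_apply_of_inCoordinates (F₁ := EuclideanSpace ℝ (Fin m)) (F₂ := ℝ)
    (E₁ := TangentSpace (𝓡 m)) (E₂ := TangentSpace 𝓘(ℝ, ℝ)) (b₁ := id) (b₂ := g) (v := X)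
    (ϕ := fun y ↦ mfderiv (𝓡 m) 𝓘(ℝ, ℝ) g y) (n := ∞)
    (hg.mfderiv_const (m := ∞) (by simp)) hX hg
  rw [contMDiffAt_totalSpace] at h1
  have h2 := h1.2
  simp at h2
  exact h2

end Calculus

/-! ### Smooth dependence of solutions of nondegenerate linear systems. -/

noncomputable section Smoothness

variable {m : ℕ} {N : Type*} [TopologicalSpace N] [ChartedSpace (EuclideanSpace ℝ (Fin m)) N]

lemma contMDiffAt_det {ι : Type*} [Fintype ι] [DecidableEq ι] {M : N → Matrix ι ι ℝ} {x : N}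
    (hM : ∀ i j, ContMDiffAt (𝓡 m) 𝓘(ℝ, ℝ) ∞ (fun y ↦ M y i j) x) :
    ContMDiffAt (𝓡 m) 𝓘(ℝ, ℝ) ∞ (fun y ↦ (M y).det) x := by
  simp only [Matrix.det_apply']
  exact ContMDiffAt.sum fun σ _ ↦ contMDiffAt_const.mul (ContMDiffAt.prod fun i _ ↦ hM _ _)

/-- The solution of a regular linear system with smooth coefficients is smooth. -/
lemma contMDiffAt_of_mulVec {ι : Type*} [Fintype ι] [DecidableEq ι] {M : N → Matrix ι ι ℝ}
    {u : N → ι → ℝ} {x : N}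
    (hM : ∀ i j, ContMDiffAt (𝓡 m) 𝓘(ℝ, ℝ) ∞ (fun y ↦ M y i j) x)
    (hu : ∀ i, ContMDiffAt (𝓡 m) 𝓘(ℝ, ℝ) ∞ (fun y ↦ (M y).mulVec (u y) i) x)
    (hdet : (M x).det ≠ 0) (i : ι) :
    ContMDiffAt (𝓡 m) 𝓘(ℝ, ℝ) ∞ (fun y ↦ u y i) x := by
  have hd := contMDiffAt_det hM
  have hn : ∀ᶠ y in nhds x, (M y).det ≠ 0 := hd.continuousAt.eventually_ne hdet
  -- Cramer's rule: this quotient of determinants is smooth near `x` and equals `u y i` wherever the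
  -- determinant is nonzero.
  have hc : ContMDiffAt (𝓡 m) 𝓘(ℝ, ℝ) ∞
      (fun y ↦ ((M y).det)⁻¹ * ((M y).updateCol i ((M y).mulVec (u y))).det) x := by
    refine (hd.inv₀ hdet).mul (contMDiffAt_det fun k j ↦ ?_)
    by_cases h : j = i
    · subst h; simpa using hu k
    · simpa [h] using hM k j
  refine hc.congr_of_eventuallyEq (hn.mono fun y hy ↦ ?_)
  have h1 : (M y).cramer ((M y).mulVec (u y)) = (M y).det • u y := by
    rw [Matrix.cramer_eq_adjugate_mulVec, Matrix.mulVec_mulVec, Matrix.adjugate_mul,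
      Matrix.smul_mulVec, Matrix.one_mulVec]
  have h2 := congrFun h1 i
  rw [Matrix.cramer_apply] at h2
  simp only [h2, Pi.smul_apply, smul_eq_mul]
  field_simp

variable [IsManifold (𝓡 m) ∞ N]

/-- The domain of the tangent bundle trivialization at `x₀`. -/
def frameSet (x₀ : N) : Set N :=
  (trivializationAt (EuclideanSpace ℝ (Fin m)) (TangentSpace (𝓡 m)) x₀).baseSet

/-- The local frame of the tangent bundle given by the trivialization at `x₀`. -/
def frame (x₀ : N) (i : Fin m) : VecField m N :=
  (trivializationAt (EuclideanSpace ℝ (Fin m)) (TangentSpace (𝓡 m)) x₀).localFrame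
    (EuclideanSpace.basisFun (Fin m) ℝ).toBasis i

lemma isLocalFrameOn_frame (x₀ : N) :
    IsLocalFrameOn (𝓡 m) (EuclideanSpace ℝ (Fin m)) ∞ (frame (m := m) x₀) (frameSet (m := m) x₀) :=
  Trivialization.isLocalFrameOn_localFrame_baseSet _ _ _ _

lemma isOpen_frameSet (x₀ : N) : IsOpen (frameSet (m := m) x₀) := Trivialization.open_baseSet _

lemma mem_frameSet (x₀ : N) : x₀ ∈ frameSet (m := m) x₀ :=
  FiberBundle.mem_baseSet_trivializationAt _ _ _

lemma smoothVecAt_frame (x₀ : N) (i : Fin m) {x : N} (hx : x ∈ frameSet (m := m) x₀) :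
    SmoothVecAt (frame (m := m) x₀ i) x :=
  (isLocalFrameOn_frame x₀).contMDiffAt (isOpen_frameSet x₀) hx i

lemma smoothVecAt_of_coeff {V : VecField m N} {x : N}
    (h : ∀ i, ContMDiffAt (𝓡 m) 𝓘(ℝ, ℝ) ∞
      (fun y ↦ (isLocalFrameOn_frame (m := m) x).coeff i y (V y)) x) : SmoothVecAt V x :=
  (isLocalFrameOn_frame x).contMDiffAt_of_coeff h
    ((isOpen_frameSet x).mem_nhds (mem_frameSet x))

/-- The pointwise nondegeneracy of the bilinear form
`((v, c), (w, b)) ↦ γ(v, w) + c ℓ(w) + b ℓ(v) + b c ℓ₂`. -/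
def NondegAt (γ : TwoTensor m N) (ell : OneForm m N) (ell2 : N → ℝ) (x : N) : Prop :=
  ∀ (v : TangentSpace (𝓡 m) x) (c : ℝ), (∀ w, γ x v w + c * ell x w = 0) →
    ell x v + c * ell2 x = 0 → v = 0 ∧ c = 0

/-- The vector field and the scalar field solving a nondegenerate system with smooth data are
smooth. -/
lemma smoothAt_of_nondegAt {γ : TwoTensor m N} {ell : OneForm m N} {ell2 : N → ℝ} {x : N}
    (hγ : SmoothTwoTensorAt γ x) (hl : SmoothFormAt ell x)
    (hl2 : ContMDiffAt (𝓡 m) 𝓘(ℝ, ℝ) ∞ ell2 x) (hnd : NondegAt γ ell ell2 x)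
    {V : VecField m N} {c : N → ℝ}
    (h1 : ∀ W : VecField m N, SmoothVecAt W x →
      ContMDiffAt (𝓡 m) 𝓘(ℝ, ℝ) ∞ (fun y ↦ γ y (V y) (W y) + c y * ell y (W y)) x)
    (h2 : ContMDiffAt (𝓡 m) 𝓘(ℝ, ℝ) ∞ (fun y ↦ ell y (V y) + c y * ell2 y) x) :
    SmoothVecAt V x ∧ ContMDiffAt (𝓡 m) 𝓘(ℝ, ℝ) ∞ c x := by
  have hfr := isLocalFrameOn_frame (m := m) x
  have hs := fun i ↦ smoothVecAt_frame (m := m) x i (mem_frameSet (m := m) x)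
  -- The Gram matrix of the form on `T N × ℝ` in the local frame, bordered by `ℓ` and `ℓ⁽²⁾`; `u`
  -- collects the frame coefficients of `V` together with `c`.
  let M : N → Matrix (Fin m ⊕ Unit) (Fin m ⊕ Unit) ℝ := fun y ↦ Matrix.fromBlocks
    (Matrix.of fun j i ↦ γ y (frame x i y) (frame x j y)) (Matrix.of fun j _ ↦ ell y (frame x j y))
    (Matrix.of fun _ i ↦ ell y (frame x i y)) (Matrix.of fun _ _ ↦ ell2 y)
  let u : N → (Fin m ⊕ Unit) → ℝ := fun y ↦ Sum.elim (fun i ↦ hfr.coeff i y (V y)) fun _ ↦ c y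
  have hV : ∀ y ∈ frameSet (m := m) x, V y = ∑ i, hfr.coeff i y (V y) • frame x i y :=
    fun y hy ↦ hfr.coeff_sum_eq V hy
  have hmem := (isOpen_frameSet (m := m) x).mem_nhds (mem_frameSet x)
  have key := contMDiffAt_of_mulVec (m := m) (M := M) (u := u) (x := x) ?_ ?_ ?_
  · exact ⟨smoothVecAt_of_coeff fun i ↦ key (Sum.inl i), key (Sum.inr ())⟩
  · rintro (j | j) (i | i)
    · exact hγ.apply (hs i) (hs j)
    · exact hl.apply (hs j)
    · exact hl.apply (hs i)
    · exact hl2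
  · rintro (j | j)
    · refine (h1 _ (hs j)).congr_of_eventuallyEq (Filter.eventually_of_mem hmem fun y hy ↦ ?_)
      beta_reduce
      conv_rhs => rw [hV y hy]
      simp [M, u, Matrix.mulVec, dotProduct, mul_comm]
    · refine h2.congr_of_eventuallyEq (Filter.eventually_of_mem hmem fun y hy ↦ ?_)
      beta_reduce
      conv_rhs => rw [hV y hy]
      simp [M, u, Matrix.mulVec, dotProduct, mul_comm]
  -- A kernel vector of the matrix at `x` would assemble into a nonzero element of the radical.
  · intro hdet
    obtain ⟨w, hw0, hw⟩ := Matrix.exists_mulVec_eq_zero_iff.mpr hdet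
    have := hnd (∑ i, w (Sum.inl i) • frame x i x) (w (Sum.inr ())) ?_ ?_
    · apply hw0
      obtain ⟨ha, hc⟩ := this
      have hli := Fintype.linearIndependent_iff.mp (hfr.linearIndependent (mem_frameSet x)) _ ha
      ext (i | i)
      · exact hli i
      · exact hc
    · intro v
      have hv := hfr.toBasisAt (mem_frameSet x) |>.sum_repr v
      rw [← hv]
      simp only [map_sum, map_smul, IsLocalFrameOn.toBasisAt_coe, Finset.mul_sum,
        ← Finset.sum_add_distrib]
      refine Finset.sum_eq_zero fun j _ ↦ ?_
      have hj := congrFun hw (Sum.inl j)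
      simp [M, Matrix.mulVec, dotProduct] at hj
      simp only [smul_eq_mul, sum_apply, smul_apply]
      rw [← mul_zero ((hfr.toBasisAt (mem_frameSet x)).repr v j), ← hj, mul_add]
      congr 1
      · simp [mul_comm]
      · ring
    · have hj := congrFun hw (Sum.inr ())
      simp [M, Matrix.mulVec, dotProduct] at hj
      simp only [map_sum, map_smul, smul_eq_mul]
      rw [← hj]
      simp [mul_comm]

/-- An endomorphism field mapping smooth vector fields to smooth vector fields is smooth. -/
lemma contMDiffAt_hom_of_apply {A : Π x : N, TangentSpace (𝓡 m) x →L[ℝ] TangentSpace (𝓡 m) x}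
    {x : N} (h : ∀ i, SmoothVecAt (fun y ↦ A y (frame x i y)) x) :
    ContMDiffAt (𝓡 m) ((𝓡 m).prod 𝓘(ℝ, EuclideanSpace ℝ (Fin m) →L[ℝ] EuclideanSpace ℝ (Fin m))) ∞
      (fun y ↦ TotalSpace.mk' (EuclideanSpace ℝ (Fin m) →L[ℝ] EuclideanSpace ℝ (Fin m))
        (E := fun y : N ↦ TangentSpace (𝓡 m) y →L[ℝ] TangentSpace (𝓡 m) y) y (A y)) x := by
  rw [contMDiffAt_hom_bundle]
  refine ⟨contMDiffAt_id, ?_⟩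
  have hi : ∀ i, ContMDiffAt (𝓡 m) 𝓘(ℝ, EuclideanSpace ℝ (Fin m)) ∞
      (fun y ↦ (trivializationAt (EuclideanSpace ℝ (Fin m)) (TangentSpace (𝓡 m)) x
        ⟨y, A y (frame x i y)⟩).2) x := by
    intro i
    have := h i
    unfold SmoothVecAt at this
    rw [contMDiffAt_totalSpace] at this
    exact this.2
  -- The coordinate expression of `A`: the sum over `i` of the `i`-th coordinate functional times
  -- the coordinates of `A` on the `i`-th frame field.
  have hsum : ContMDiffAt (𝓡 m) 𝓘(ℝ, EuclideanSpace ℝ (Fin m) →L[ℝ] EuclideanSpace ℝ (Fin m)) ∞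
      (fun y ↦ ∑ i, (EuclideanSpace.proj i : EuclideanSpace ℝ (Fin m) →L[ℝ] ℝ).smulRight
        (trivializationAt (EuclideanSpace ℝ (Fin m)) (TangentSpace (𝓡 m)) x
        ⟨y, A y (frame x i y)⟩).2) x := by
    refine ContMDiffAt.sum fun i _ ↦ ?_
    exact ((ContinuousLinearMap.smulRightL ℝ (EuclideanSpace ℝ (Fin m)) (EuclideanSpace ℝ (Fin m))
      (EuclideanSpace.proj i)).contMDiff.contMDiffAt).comp x (hi i)
  refine hsum.congr_of_eventuallyEq (Filter.eventually_of_mem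
    ((isOpen_frameSet (m := m) x).mem_nhds (mem_frameSet x)) fun y hy ↦ ?_)
  apply ContinuousLinearMap.coe_injective
  refine (EuclideanSpace.basisFun (Fin m) ℝ).toBasis.ext fun j ↦ ?_
  have hy' : y ∈ (trivializationAt (EuclideanSpace ℝ (Fin m)) (TangentSpace (𝓡 m)) x).baseSet := hy
  have hf : frame x j y = (trivializationAt (EuclideanSpace ℝ (Fin m)) (TangentSpace (𝓡 m)) x).symmL
      ℝ y ((EuclideanSpace.basisFun (Fin m) ℝ).toBasis j) := by
    rw [frame, Trivialization.localFrame_apply_of_mem_baseSet _ _ hy', Trivialization.basisAt]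
    simp only [Module.Basis.map_apply, Trivialization.linearEquivAt_symm_apply]
    exact (Trivialization.symmL_apply _ hy' _).symm
  have hl : ∀ w : TangentSpace (𝓡 m) y,
      (trivializationAt (EuclideanSpace ℝ (Fin m)) (TangentSpace (𝓡 m)) x).continuousLinearMapAt
        ℝ y w = (trivializationAt (EuclideanSpace ℝ (Fin m)) (TangentSpace (𝓡 m)) x ⟨y, w⟩).2 :=
    fun w ↦ by rw [Trivialization.continuousLinearMapAt_apply, Trivialization.linearMapAt_apply,
      if_pos hy']
  have h1 : ContinuousLinearMap.inCoordinates (EuclideanSpace ℝ (Fin m)) (TangentSpace (𝓡 m))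
      (EuclideanSpace ℝ (Fin m)) (TangentSpace (𝓡 m)) x y x y (A y)
      ((EuclideanSpace.basisFun (Fin m) ℝ).toBasis j) =
      (trivializationAt (EuclideanSpace ℝ (Fin m)) (TangentSpace (𝓡 m)) x
        ⟨y, A y (frame x j y)⟩).2 := by
    rw [← hl, hf]
    rfl
  refine h1.trans ?_
  simp [Finset.sum_apply]

end Smoothness

/-! ### The connection defined by Koszul expressions and a nondegenerate form. -/

noncomputable section Koszul

variable {m : ℕ} {N : Type*} [TopologicalSpace N] [ChartedSpace (EuclideanSpace ℝ (Fin m)) N]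

/-- The Koszul expression of the symmetric two-tensor `γ`. -/
def koszul (γ : TwoTensor m N) (X Z W : VecField m N) (x : N) : ℝ :=
  (1 / 2) * (dirDeriv X (fun y ↦ γ y (Z y) (W y)) x + dirDeriv Z (fun y ↦ γ y (X y) (W y)) x
    - dirDeriv W (fun y ↦ γ y (X y) (Z y)) x + γ x (bracket X Z x) (W x)
    - γ x (bracket Z W x) (X x) + γ x (bracket W X x) (Z x))

/-- The analogue of the Koszul expression for the one-form `ell`. -/
def koszulForm (ell : OneForm m N) (X Z : VecField m N) (x : N) : ℝ :=
  (1 / 2) * (dirDeriv X (fun y ↦ ell y (Z y)) x + dirDeriv Z (fun y ↦ ell y (X y)) x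
    + ell x (bracket X Z x))

variable {γ : TwoTensor m N} {ell : OneForm m N} {ell2 : N → ℝ} {x : N}
  {X X' Z Z' W W' : VecField m N} {g : N → ℝ}

/-- Source of torsion-freeness; `koszulForm_sub_swap` is its counterpart in the `ℓ` direction. -/
lemma koszul_sub_swap (hsymm : ∀ x (v w : TangentSpace (𝓡 m) x), γ x v w = γ x w v) :
    koszul γ X Z W x - koszul γ Z X W x = γ x (bracket X Z x) (W x) := by
  simp only [koszul, bracket_swap (X := Z) (Y := X), bracket_swap (X := W) (Y := X),
    bracket_swap (X := W) (Y := Z), hsymm _ (Z _) (X _), map_neg, neg_apply]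
  ring

/-- Source of the formula for `∇γ`: what remains after subtracting `γ(∇_X Z, W)` and `γ(Z, ∇_X W)`
is carried by the scalar parts. -/
lemma koszul_add_swap (hsymm : ∀ x (v w : TangentSpace (𝓡 m) x), γ x v w = γ x w v) :
    koszul γ X Z W x + koszul γ X W Z x = dirDeriv X (fun y ↦ γ y (Z y) (W y)) x := by
  simp only [koszul, bracket_swap (X := Z) (Y := X), bracket_swap (X := W) (Y := X),
    bracket_swap (X := W) (Y := Z), hsymm _ (W _) (Z _), map_neg, neg_apply]
  ring

lemma koszulForm_sub_swap : koszulForm ell X Z x - koszulForm ell Z X x =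
    ell x (bracket X Z x) := by
  simp only [koszulForm, bracket_swap (X := Z) (Y := X), map_neg]
  ring

lemma koszulForm_add_swap : koszulForm ell X Z x + koszulForm ell Z X x =
    dirDeriv X (fun y ↦ ell y (Z y)) x + dirDeriv Z (fun y ↦ ell y (X y)) x := by
  simp only [koszulForm, bracket_swap (X := Z) (Y := X), map_neg]
  ring

variable [IsManifold (𝓡 m) ∞ N]

lemma koszul_add_left (hγ : SmoothTwoTensorAt γ x) (hX : DiffVecAt X x) (hX' : DiffVecAt X' x)
    (hZ : DiffVecAt Z x) (hW : DiffVecAt W x) :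
    koszul γ (X + X') Z W x = koszul γ X Z W x + koszul γ X' Z W x := by
  simp only [koszul, Pi.add_apply, map_add, add_apply, dirDeriv_add_left,
    dirDeriv_add (hγ.mdifferentiableAt_apply hX hW) (hγ.mdifferentiableAt_apply hX' hW),
    dirDeriv_add (hγ.mdifferentiableAt_apply hX hZ) (hγ.mdifferentiableAt_apply hX' hZ),
    bracket_add_left hX hX', bracket_add_right hX hX']
  ring

lemma koszul_add_middle (hγ : SmoothTwoTensorAt γ x) (hX : DiffVecAt X x) (hZ : DiffVecAt Z x)
    (hZ' : DiffVecAt Z' x) (hW : DiffVecAt W x) :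
    koszul γ X (Z + Z') W x = koszul γ X Z W x + koszul γ X Z' W x := by
  simp only [koszul, Pi.add_apply, map_add, add_apply, dirDeriv_add_left,
    dirDeriv_add (hγ.mdifferentiableAt_apply hZ hW) (hγ.mdifferentiableAt_apply hZ' hW),
    dirDeriv_add (hγ.mdifferentiableAt_apply hX hZ) (hγ.mdifferentiableAt_apply hX hZ'),
    bracket_add_left hZ hZ', bracket_add_right hZ hZ']
  ring

lemma koszul_add_right (hγ : SmoothTwoTensorAt γ x) (hX : DiffVecAt X x) (hZ : DiffVecAt Z x)
    (hW : DiffVecAt W x) (hW' : DiffVecAt W' x) :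
    koszul γ X Z (W + W') x = koszul γ X Z W x + koszul γ X Z W' x := by
  simp only [koszul, Pi.add_apply, map_add, add_apply, dirDeriv_add_left,
    dirDeriv_add (hγ.mdifferentiableAt_apply hX hW) (hγ.mdifferentiableAt_apply hX hW'),
    dirDeriv_add (hγ.mdifferentiableAt_apply hZ hW) (hγ.mdifferentiableAt_apply hZ hW'),
    bracket_add_left hW hW', bracket_add_right hW hW']
  ring

lemma koszul_smul_left (hsymm : ∀ x (v w : TangentSpace (𝓡 m) x), γ x v w = γ x w v)
    (hγ : SmoothTwoTensorAt γ x) (hg : MDifferentiableAt (𝓡 m) 𝓘(ℝ, ℝ) g x)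
    (hX : DiffVecAt X x) (hZ : DiffVecAt Z x) (hW : DiffVecAt W x) :
    koszul γ (g • X) Z W x = g x * koszul γ X Z W x := by
  simp only [koszul, Pi.smul_apply', map_smul, map_add, smul_apply, add_apply, smul_eq_mul,
    dirDeriv_smul_left, dirDeriv_mul hg (hγ.mdifferentiableAt_apply hX hW),
    dirDeriv_mul hg (hγ.mdifferentiableAt_apply hX hZ),
    bracket_smul_left hg hX, bracket_smul_right hg hX, hsymm x (X x) (Z x)]
  ring

/-- The middle slot is the only one that is not tensorial; the extra term becomes the Leibniz rule
of the connection. -/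
lemma koszul_smul_middle (hsymm : ∀ x (v w : TangentSpace (𝓡 m) x), γ x v w = γ x w v)
    (hγ : SmoothTwoTensorAt γ x) (hg : MDifferentiableAt (𝓡 m) 𝓘(ℝ, ℝ) g x)
    (hX : DiffVecAt X x) (hZ : DiffVecAt Z x) (hW : DiffVecAt W x) :
    koszul γ X (g • Z) W x = g x * koszul γ X Z W x + dirDeriv X g x * γ x (Z x) (W x) := by
  simp only [koszul, Pi.smul_apply', map_smul, map_add, smul_apply, add_apply, smul_eq_mul,
    dirDeriv_smul_left, dirDeriv_mul hg (hγ.mdifferentiableAt_apply hZ hW),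
    dirDeriv_mul hg (hγ.mdifferentiableAt_apply hX hZ),
    bracket_smul_left hg hZ, bracket_smul_right hg hZ, hsymm x (X x) (Z x)]
  ring

lemma koszul_smul_right (hsymm : ∀ x (v w : TangentSpace (𝓡 m) x), γ x v w = γ x w v)
    (hγ : SmoothTwoTensorAt γ x) (hg : MDifferentiableAt (𝓡 m) 𝓘(ℝ, ℝ) g x)
    (hX : DiffVecAt X x) (hZ : DiffVecAt Z x) (hW : DiffVecAt W x) :
    koszul γ X Z (g • W) x = g x * koszul γ X Z W x := by
  simp only [koszul, Pi.smul_apply', map_smul, map_add, smul_apply, add_apply, smul_eq_mul,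
    dirDeriv_smul_left, dirDeriv_mul hg (hγ.mdifferentiableAt_apply hX hW),
    dirDeriv_mul hg (hγ.mdifferentiableAt_apply hZ hW),
    bracket_smul_left hg hW, bracket_smul_right hg hW, hsymm x (W x)]
  ring

lemma koszulForm_add_left (hl : SmoothFormAt ell x) (hX : DiffVecAt X x) (hX' : DiffVecAt X' x) :
    koszulForm ell (X + X') Z x = koszulForm ell X Z x + koszulForm ell X' Z x := by
  simp only [koszulForm, Pi.add_apply, map_add, dirDeriv_add_left,
    dirDeriv_add (hl.mdifferentiableAt_apply hX) (hl.mdifferentiableAt_apply hX'),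
    bracket_add_left hX hX']
  ring

lemma koszulForm_add_right (hl : SmoothFormAt ell x) (hZ : DiffVecAt Z x)
    (hZ' : DiffVecAt Z' x) :
    koszulForm ell X (Z + Z') x = koszulForm ell X Z x + koszulForm ell X Z' x := by
  simp only [koszulForm, Pi.add_apply, map_add, dirDeriv_add_left,
    dirDeriv_add (hl.mdifferentiableAt_apply hZ) (hl.mdifferentiableAt_apply hZ'),
    bracket_add_right hZ hZ']
  ring

lemma koszulForm_smul_left (hl : SmoothFormAt ell x)
    (hg : MDifferentiableAt (𝓡 m) 𝓘(ℝ, ℝ) g x) (hX : DiffVecAt X x) :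
    koszulForm ell (g • X) Z x = g x * koszulForm ell X Z x := by
  simp only [koszulForm, Pi.smul_apply', map_smul, map_add, smul_eq_mul, dirDeriv_smul_left,
    dirDeriv_mul hg (hl.mdifferentiableAt_apply hX), bracket_smul_left hg hX]
  ring

lemma koszulForm_smul_right (hl : SmoothFormAt ell x)
    (hg : MDifferentiableAt (𝓡 m) 𝓘(ℝ, ℝ) g x) (hZ : DiffVecAt Z x) :
    koszulForm ell X (g • Z) x = g x * koszulForm ell X Z x + dirDeriv X g x * ell x (Z x) := by
  simp only [koszulForm, Pi.smul_apply', map_smul, map_add, smul_eq_mul, dirDeriv_smul_left,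
    dirDeriv_mul hg (hl.mdifferentiableAt_apply hZ), bracket_smul_right hg hZ]
  ring

lemma contMDiffAt_koszul (hγ : SmoothTwoTensorAt γ x) (hX : SmoothVecAt X x)
    (hZ : SmoothVecAt Z x) (hW : SmoothVecAt W x) :
    ContMDiffAt (𝓡 m) 𝓘(ℝ, ℝ) ∞ (koszul γ X Z W) x := by
  refine contMDiffAt_const.mul ?_
  exact (((((hX.dirDeriv (hγ.apply hZ hW)).add (hZ.dirDeriv (hγ.apply hX hW))).sub
    (hW.dirDeriv (hγ.apply hX hZ))).add (hγ.apply (hX.bracket hZ) hW)).sub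
    (hγ.apply (hZ.bracket hW) hX)).add (hγ.apply (hW.bracket hX) hZ)

lemma contMDiffAt_koszulForm (hl : SmoothFormAt ell x) (hX : SmoothVecAt X x)
    (hZ : SmoothVecAt Z x) : ContMDiffAt (𝓡 m) 𝓘(ℝ, ℝ) ∞ (koszulForm ell X Z) x :=
  contMDiffAt_const.mul (((hX.dirDeriv (hl.apply hZ)).add (hZ.dirDeriv (hl.apply hX))).add
    (hl.apply (hX.bracket hZ)))

/-- The linear system defined by a nondegenerate form is uniquely solvable. -/
lemma NondegAt.exists_solution (h : NondegAt γ ell ell2 x) {E : Type*} [AddCommGroup E]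
    [Module ℝ E] (k : E →ₗ[ℝ] (TangentSpace (𝓡 m) x →L[ℝ] ℝ)) (l : E →ₗ[ℝ] ℝ) :
    ∃ (A : E →ₗ[ℝ] TangentSpace (𝓡 m) x) (c : E →ₗ[ℝ] ℝ), ∀ v,
      (∀ w, γ x (A v) w + c v * ell x w = k v w) ∧ ell x (A v) + c v * ell2 x = l v := by
  let Φ : (TangentSpace (𝓡 m) x × ℝ) →ₗ[ℝ] (Module.Dual ℝ (TangentSpace (𝓡 m) x) × ℝ) :=
    { toFun := fun p ↦ ((γ x p.1 + p.2 • ell x).toLinearMap, ell x p.1 + p.2 * ell2 x)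
      map_add' := fun p q ↦ by
        ext
        · simp; ring
        · simp; ring
      map_smul' := fun a p ↦ by
        ext
        · simp; ring
        · simp; ring }
  -- Nondegeneracy is injectivity, and source and target have equal finite dimension. Composing the
  -- inverse with the linear right-hand side makes the solution linear in the parameter.
  have hinj : Function.Injective Φ := by
    rw [← LinearMap.ker_eq_bot, LinearMap.ker_eq_bot']
    rintro ⟨v, c⟩ hp
    have h1 : (γ x v + c • ell x).toLinearMap = 0 := congrArg Prod.fst hp
    have h2 : ell x v + c * ell2 x = 0 := congrArg Prod.snd hp
    obtain ⟨rfl, rfl⟩ := h v c (fun w ↦ by simpa using congrArg (fun f ↦ f w) h1) h2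
    rfl
  have hdim : Module.finrank ℝ (TangentSpace (𝓡 m) x × ℝ) =
      Module.finrank ℝ (Module.Dual ℝ (TangentSpace (𝓡 m) x) × ℝ) := by
    rw [Module.finrank_prod, Module.finrank_prod, Subspace.dual_finrank_eq]
  let e := LinearEquiv.ofBijective Φ
    ⟨hinj, (LinearMap.injective_iff_surjective_of_finrank_eq_finrank hdim).mp hinj⟩
  let K : E →ₗ[ℝ] (Module.Dual ℝ (TangentSpace (𝓡 m) x) × ℝ) :=
    (ContinuousLinearMap.coeLM ℝ ∘ₗ k).prod l
  refine ⟨LinearMap.fst ℝ _ _ ∘ₗ e.symm.toLinearMap ∘ₗ K,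
    LinearMap.snd ℝ _ _ ∘ₗ e.symm.toLinearMap ∘ₗ K, fun v ↦ ?_⟩
  have hv : Φ (e.symm (K v)) = K v := e.apply_symm_apply (K v)
  refine ⟨fun w ↦ ?_, congrArg Prod.snd hv⟩
  have := congrArg (fun f ↦ f w) (congrArg Prod.fst hv)
  simpa [Φ, K] using this

/-- Testing on differentiable fields suffices, since every tangent vector at `x` extends to one. -/
lemma NondegAt.ext (h : NondegAt γ ell ell2 x) {v v' : TangentSpace (𝓡 m) x} {c c' : ℝ}
    (h1 : ∀ W : VecField m N, DiffVecAt W x →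
      γ x v (W x) + c * ell x (W x) = γ x v' (W x) + c' * ell x (W x))
    (h2 : ell x v + c * ell2 x = ell x v' + c' * ell2 x) : v = v' ∧ c = c' := by
  have := h (v - v') (c - c') (fun w ↦ ?_) ?_
  · exact ⟨sub_eq_zero.mp this.1, sub_eq_zero.mp this.2⟩
  · obtain ⟨W, hW, rfl⟩ := exists_diffVecAt w
    simp only [map_sub, sub_apply]
    linear_combination h1 W hW
  · simp only [map_sub]
    linear_combination h2

/-- The pair `(A, c)` represents, at `x`, the Koszul expressions with middle argument `Z`. -/
def IsKoszulSolution (γ : TwoTensor m N) (ell : OneForm m N) (ell2 : N → ℝ) (Z : VecField m N)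
    (x : N) (p : (TangentSpace (𝓡 m) x →L[ℝ] TangentSpace (𝓡 m) x) ×
      (TangentSpace (𝓡 m) x →L[ℝ] ℝ)) : Prop :=
  ∀ X : VecField m N, DiffVecAt X x →
    (∀ W : VecField m N, DiffVecAt W x →
      γ x (p.1 (X x)) (W x) + p.2 (X x) * ell x (W x) = koszul γ X Z W x) ∧
    ell x (p.1 (X x)) + p.2 (X x) * ell2 x = koszulForm ell X Z x

/-- The right-hand sides are tensorial in `X` and `W`, so they descend to linear data on the tangent
space at `x`, and the pointwise system can be solved linearly in `X x`. -/
lemma exists_isKoszulSolution (hsymm : ∀ x (v w : TangentSpace (𝓡 m) x), γ x v w = γ x w v)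
    (hγ : SmoothTwoTensorAt γ x) (hl : SmoothFormAt ell x) (hnd : NondegAt γ ell ell2 x)
    (hZ : DiffVecAt Z x) : ∃ p, IsKoszulSolution γ ell ell2 Z x p := by
  have : T2Space (TangentSpace (𝓡 m) x) := inferInstanceAs (T2Space (EuclideanSpace ℝ (Fin m)))
  have hK1 : ∀ W : VecField m N, DiffVecAt W x → TensorialAt (𝓡 m) (EuclideanSpace ℝ (Fin m))
      (fun X ↦ koszul γ X Z W x) x := fun W hW ↦
    { smul := fun hg hX ↦ koszul_smul_left hsymm hγ hg hX hZ hW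
      add := fun hX hX' ↦ koszul_add_left hγ hX hX' hZ hW }
  have hK2 : ∀ X : VecField m N, DiffVecAt X x → TensorialAt (𝓡 m) (EuclideanSpace ℝ (Fin m))
      (fun W ↦ koszul γ X Z W x) x := fun X hX ↦
    { smul := fun hg hW ↦ koszul_smul_right hsymm hγ hg hX hZ hW
      add := fun hW hW' ↦ koszul_add_right hγ hX hZ hW hW' }
  have hL : TensorialAt (𝓡 m) (EuclideanSpace ℝ (Fin m)) (fun X ↦ koszulForm ell X Z x) x :=
    { smul := fun hg hX ↦ koszulForm_smul_left hl hg hX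
      add := fun hX hX' ↦ koszulForm_add_left hl hX hX' }
  obtain ⟨A, c, hAc⟩ := hnd.exists_solution
    (TensorialAt.mkHom₂ (fun X W ↦ koszul γ X Z W x) x hK1 hK2).toLinearMap
    (TensorialAt.mkHom _ x hL).toLinearMap
  refine ⟨(A.toContinuousLinearMap, c.toContinuousLinearMap), fun X hX ↦ ⟨fun W hW ↦ ?_, ?_⟩⟩
  · exact ((hAc (X x)).1 (W x)).trans (TensorialAt.mkHom₂_apply hK1 hK2 hX hW)
  · exact (hAc (X x)).2.trans (TensorialAt.mkHom_apply hL hX)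

/-- The hypotheses on `(γ, ell, ell2)` under which the Koszul expressions define a connection
on `S`. -/
structure IsRegularOn (γ : TwoTensor m N) (ell : OneForm m N) (ell2 : N → ℝ) (S : Set N) :
    Prop where
  isOpen : IsOpen S
  symm : ∀ x (v w : TangentSpace (𝓡 m) x), γ x v w = γ x w v
  smoothTensor : ∀ x ∈ S, SmoothTwoTensorAt γ x
  smoothForm : ∀ x ∈ S, SmoothFormAt ell x
  smoothFun : ∀ x ∈ S, ContMDiffAt (𝓡 m) 𝓘(ℝ, ℝ) ∞ ell2 x
  nondeg : ∀ x ∈ S, NondegAt γ ell ell2 x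

open Classical in
/-- The connection defined by the Koszul expressions together with its scalar part. -/
def koszulPair (γ : TwoTensor m N) (ell : OneForm m N) (ell2 : N → ℝ) (Z : VecField m N) (x : N) :
    (TangentSpace (𝓡 m) x →L[ℝ] TangentSpace (𝓡 m) x) × (TangentSpace (𝓡 m) x →L[ℝ] ℝ) :=
  if h : ∃ p, IsKoszulSolution γ ell ell2 Z x p then h.choose else 0

namespace IsRegularOn

variable {S : Set N} (h : IsRegularOn γ ell ell2 S)
include h

/-- At points of `S` and for differentiable `Z` the default value in `koszulPair` is never taken. -/
lemma isKoszulSolution (hx : x ∈ S) (hZ : DiffVecAt Z x) :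
    IsKoszulSolution γ ell ell2 Z x (koszulPair γ ell ell2 Z x) := by
  have := exists_isKoszulSolution h.symm (h.smoothTensor x hx) (h.smoothForm x hx) (h.nondeg x hx)
    hZ
  rw [koszulPair, dif_pos this]
  exact this.choose_spec

lemma koszulPair_add (hx : x ∈ S) (hZ : DiffVecAt Z x) (hZ' : DiffVecAt Z' x) :
    koszulPair γ ell ell2 (Z + Z') x = koszulPair γ ell ell2 Z x + koszulPair γ ell ell2 Z' x := by
  have key : ∀ v, (koszulPair γ ell ell2 (Z + Z') x).1 v =
      (koszulPair γ ell ell2 Z x).1 v + (koszulPair γ ell ell2 Z' x).1 v ∧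
      (koszulPair γ ell ell2 (Z + Z') x).2 v =
      (koszulPair γ ell ell2 Z x).2 v + (koszulPair γ ell ell2 Z' x).2 v := by
    intro v
    obtain ⟨X, hX, rfl⟩ := exists_diffVecAt v
    have h0 := h.isKoszulSolution hx (hZ.add hZ') X hX
    have h1 := h.isKoszulSolution hx hZ X hX
    have h2 := h.isKoszulSolution hx hZ' X hX
    refine (h.nondeg x hx).ext (fun W hW ↦ ?_) ?_
    · rw [h0.1 W hW, koszul_add_middle (h.smoothTensor x hx) hX hZ hZ' hW, ← h1.1 W hW,
        ← h2.1 W hW, map_add, add_apply]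
      ring
    · rw [h0.2, koszulForm_add_right (h.smoothForm x hx) hZ hZ', ← h1.2, ← h2.2, map_add]
      ring
  ext v
  · simp [(key v).1]
  · simp [(key v).2]

lemma koszulPair_smul (hx : x ∈ S) (hg : MDifferentiableAt (𝓡 m) 𝓘(ℝ, ℝ) g x)
    (hZ : DiffVecAt Z x) :
    (koszulPair γ ell ell2 (g • Z) x).1 =
      g x • (koszulPair γ ell ell2 Z x).1 + (mvfderiv (𝓡 m) g x).smulRight (Z x) := by
  ext1 v
  obtain ⟨X, hX, rfl⟩ := exists_diffVecAt v
  have h0 := h.isKoszulSolution hx (hZ.smul hg) X hX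
  have h1 := h.isKoszulSolution hx hZ X hX
  -- The inhomogeneous terms `X(g) γ(Z, W)` and `X(g) ℓ(Z)` are both absorbed by adding `X(g) Z` to
  -- the vector part, so the scalar part merely scales by `g`.
  refine ((h.nondeg x hx).ext (c := (koszulPair γ ell ell2 (g • Z) x).2 (X x)) (c' := g x * (koszulPair γ ell ell2 Z x).2 (X x))
    (fun W hW ↦ ?_) ?_).1
  · rw [h0.1 W hW, koszul_smul_middle h.symm (h.smoothTensor x hx) hg hX hZ hW, ← h1.1 W hW]
    simp [dirDeriv]
    ring
  · rw [h0.2, koszulForm_smul_right (h.smoothForm x hx) hg hZ, ← h1.2]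
    simp [dirDeriv]
    ring

lemma koszulPair_swap (hx : x ∈ S) (hX : DiffVecAt X x) (hZ : DiffVecAt Z x) :
    (koszulPair γ ell ell2 Z x).1 (X x) =
      (koszulPair γ ell ell2 X x).1 (Z x) + bracket X Z x ∧
    (koszulPair γ ell ell2 Z x).2 (X x) = (koszulPair γ ell ell2 X x).2 (Z x) := by
  have h0 := h.isKoszulSolution hx hZ X hX
  have h1 := h.isKoszulSolution hx hX Z hZ
  refine (h.nondeg x hx).ext (fun W hW ↦ ?_) ?_
  · have := koszul_sub_swap h.symm (X := X) (Z := Z) (W := W) (x := x)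
    rw [← h0.1 W hW, ← h1.1 W hW] at this
    simp only [map_add, add_apply]
    linear_combination this
  · have := koszulForm_sub_swap (ell := ell) (X := X) (Z := Z) (x := x)
    rw [← h0.2, ← h1.2] at this
    simp only [map_add]
    linear_combination this

lemma contMDiffAt_koszulPair (hx : x ∈ S) (hZ : ∀ y ∈ S, SmoothVecAt Z y)
    (hX : SmoothVecAt X x) :
    SmoothVecAt (fun y ↦ (koszulPair γ ell ell2 Z y).1 (X y)) x := by
  have hS := h.isOpen.mem_nhds hx
  refine (smoothAt_of_nondegAt (c := fun y ↦ (koszulPair γ ell ell2 Z y).2 (X y))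
    (h.smoothTensor x hx) (h.smoothForm x hx) (h.smoothFun x hx) (h.nondeg x hx)
    (fun W hW ↦ ?_) ?_).1
  · refine (contMDiffAt_koszul (h.smoothTensor x hx) hX (hZ x hx) hW).congr_of_eventuallyEq ?_
    filter_upwards [hS, hX.eventually_diffVecAt, hW.eventually_diffVecAt] with y hy hXy hWy
    exact (h.isKoszulSolution hy (hZ y hy).diffVecAt X hXy).1 W hWy
  · refine (contMDiffAt_koszulForm (h.smoothForm x hx) hX (hZ x hx)).congr_of_eventuallyEq ?_
    filter_upwards [hS, hX.eventually_diffVecAt] with y hy hXy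
    exact (h.isKoszulSolution hy (hZ y hy).diffVecAt X hXy).2

/-- The Koszul expressions define a smooth torsion-free connection. -/
lemma isTorsionFreeConnectionOn :
    IsTorsionFreeConnectionOn (fun Z x ↦ (koszulPair γ ell ell2 Z x).1) S where
  isCovariantDerivativeOn :=
    { add := fun hσ hσ' hx ↦ congrArg Prod.fst (h.koszulPair_add hx hσ hσ')
      leibniz := fun hσ hg hx ↦ h.koszulPair_smul hx hg hσ }
  smooth := by
    constructor
    intro σ hσ x hx
    refine (contMDiffAt_hom_of_apply fun i ↦ ?_).contMDiffWithinAt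
    exact h.contMDiffAt_koszulPair hx
      (fun y hy ↦ ContMDiffOn.contMDiffAt hσ (h.isOpen.mem_nhds hy))
      (smoothVecAt_frame x i (mem_frameSet x))
  torsionFree := fun x hx X Y hX hY ↦ by
    simp only [covVec, (h.koszulPair_swap hx hX hY).1]
    abel

end IsRegularOn

end Koszul

/-! ### Existence of the two connections, and regularity at non-null points. -/

noncomputable section Existence

variable {m : ℕ} {N : Type*} [TopologicalSpace N] [ChartedSpace (EuclideanSpace ℝ (Fin m)) N]
  [IsManifold (𝓡 m) ∞ N]

namespace MetricHypersurfaceData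

variable (D : MetricHypersurfaceData m N) {S : Set N} {x : N} {X Y Z W : VecField m N}

lemma nondegAt (x : N) : NondegAt D.γ D.ell D.ell2 x := by
  intro v c h1 h2
  have h : (v, c) = (0 : TangentSpace (𝓡 m) x × ℝ) := (D.nondegenerate x).1 (v, c) fun q ↦ by
    simp only [ambientForm, LinearMap.mk₂_apply]
    change D.γ x v q.1 + c * D.ell x q.1 + q.2 * D.ell x v + c * q.2 * D.ell2 x = 0
    linear_combination h1 q.1 + q.2 * h2
  exact ⟨congrArg Prod.fst h, congrArg Prod.snd h⟩

lemma isRegularOn_univ : IsRegularOn D.γ D.ell D.ell2 univ where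
  isOpen := isOpen_univ
  symm := D.γ_symm
  smoothTensor := fun _ hx ↦ D.γ_smooth.smoothTwoTensorAt isOpen_univ hx
  smoothForm := fun _ hx ↦ D.ell_smooth.smoothFormAt isOpen_univ hx
  smoothFun := fun x _ ↦ D.ell2_smooth x
  nondeg := fun x _ ↦ D.nondegAt x

lemma smoothTwoTensorAt_γ : SmoothTwoTensorAt D.γ x := D.isRegularOn_univ.smoothTensor x trivial

lemma smoothFormAt_ell : SmoothFormAt D.ell x := D.isRegularOn_univ.smoothForm x trivial

lemma ambient_n (w : TangentSpace (𝓡 m) x) (b : ℝ) :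
    D.γ x (D.n x) w + D.n2 x * D.ell x w + b * D.ell x (D.n x) + D.n2 x * b * D.ell2 x = b :=
  LinearMap.BilinForm.apply_toDual_symm_apply (hB := D.nondegenerate x)
    (LinearMap.snd ℝ (TangentSpace (𝓡 m) x) ℝ) (w, b)

lemma γ_n (w : TangentSpace (𝓡 m) x) : D.γ x (D.n x) w + D.n2 x * D.ell x w = 0 := by
  simpa using D.ambient_n w 0

lemma ell_n : D.ell x (D.n x) + D.n2 x * D.ell2 x = 1 := by
  simpa using D.ambient_n (x := x) 0 1

lemma smoothAt_n : SmoothVecAt D.n x ∧ ContMDiffAt (𝓡 m) 𝓘(ℝ, ℝ) ∞ D.n2 x := by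
  refine smoothAt_of_nondegAt D.smoothTwoTensorAt_γ D.smoothFormAt_ell (D.ell2_smooth x)
    (D.nondegAt x) (fun W _ ↦ ?_) ?_
  · simp only [γ_n]
    exact contMDiffAt_const
  · simp only [ell_n]
    exact contMDiffAt_const

/-- Substituting `γ(n, ·) = -n⁽²⁾ ℓ`, the product rule yields the terms with `dn⁽²⁾`, while the
remaining derivative along `n` and the brackets with `n` assemble into `𝓛_n γ`. -/
lemma koszul_n (hX : DiffVecAt X x) (hZ : DiffVecAt Z x) :
    koszul D.γ X Z D.n x = - D.n2 x * koszulForm D.ell X Z x - D.U X Z x := by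
  have h2 : MDifferentiableAt (𝓡 m) 𝓘(ℝ, ℝ) D.n2 x := D.smoothAt_n.2.mdifferentiableAt (by simp)
  have hn : ∀ y (v : TangentSpace (𝓡 m) y), D.γ y v (D.n y) = -(D.n2 y * D.ell y v) := fun y v ↦ by
    rw [D.γ_symm]
    linear_combination D.γ_n v
  simp only [koszul, koszulForm, U, lieDeriv, hn, dirDeriv_neg,
    dirDeriv_mul h2 (D.smoothFormAt_ell.mdifferentiableAt_apply hX),
    dirDeriv_mul h2 (D.smoothFormAt_ell.mdifferentiableAt_apply hZ),
    bracket_swap (X := Z) (Y := D.n), map_neg, neg_apply, D.γ_symm x (X x)]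
  ring

/-- Test the first equation against `W = n`: the two relations defining `n` and `n⁽²⁾`, with the
second equation of the system, isolate the scalar part. -/
lemma koszulPair_snd (hX : DiffVecAt X x) (hZ : DiffVecAt Z x) :
    (koszulPair D.γ D.ell D.ell2 Z x).2 (X x) = - D.U X Z x := by
  obtain ⟨h1, h2⟩ := D.isRegularOn_univ.isKoszulSolution trivial hZ X hX
  have h3 := h1 D.n D.smoothAt_n.1.diffVecAt
  rw [D.koszul_n hX hZ, D.γ_symm, ← h2] at h3
  linear_combination h3 - D.γ_n ((koszulPair D.γ D.ell D.ell2 Z x).1 (X x)) -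
    (koszulPair D.γ D.ell D.ell2 Z x).2 (X x) * D.ell_n (x := x)

theorem exists_isMetricHypersurfaceConnection :
    ∃ nabla : ConnMap m N, D.IsMetricHypersurfaceConnection nabla := by
  refine ⟨_, D.isRegularOn_univ.isTorsionFreeConnectionOn, fun x X Z W hX hZ hW ↦ ?_,
    fun x X Z hX hZ ↦ ?_⟩
  · have h1 := (D.isRegularOn_univ.isKoszulSolution trivial hZ X hX).1 W hW
    have h2 := (D.isRegularOn_univ.isKoszulSolution trivial hW X hX).1 Z hZ
    rw [D.koszulPair_snd hX hZ] at h1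
    rw [D.koszulPair_snd hX hW, D.γ_symm] at h2
    simp only [covTwo, covVec, ← koszul_add_swap D.γ_symm, ← h1, ← h2]
    ring
  · have h1 := (D.isRegularOn_univ.isKoszulSolution trivial hZ X hX).2
    have h2 := (D.isRegularOn_univ.isKoszulSolution trivial hX Z hZ).2
    rw [← (D.isRegularOn_univ.koszulPair_swap trivial hX hZ).2] at h2
    rw [D.koszulPair_snd hX hZ] at h1 h2
    have h3 := koszulForm_add_swap (ell := D.ell) (X := X) (Z := Z) (x := x)
    simp only [covForm, covVec]
    linear_combination -h3 - h1 - h2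

/-- With `(ℓ, ℓ⁽²⁾)` replaced by `(0, 1)` the form is block diagonal, so it is nondegenerate exactly
when `γ` is, and the system reduces to the classical Koszul formula. -/
lemma isRegularOn_γ (hS : IsOpen S) (h : ∀ x ∈ S, D.IsNonNull x) :
    IsRegularOn D.γ (fun _ ↦ 0) (fun _ ↦ 1) S where
  isOpen := hS
  symm := D.γ_symm
  smoothTensor := fun _ _ ↦ D.smoothTwoTensorAt_γ
  smoothForm := fun x _ ↦ Bundle.contMDiff_zeroSection (n := ∞) ℝ
    (fun y : N ↦ TangentSpace (𝓡 m) y →L[ℝ] ℝ) x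
  smoothFun := fun x _ ↦ contMDiffAt_const
  nondeg := fun x hx v c h1 h2 ↦ ⟨h x hx v fun w ↦ by simpa using h1 w, by simpa using h2⟩

theorem exists_isLeviCivitaOn (hS : IsOpen S) (h : ∀ x ∈ S, D.IsNonNull x) :
    ∃ nabla : ConnMap m N, IsLeviCivitaOn D.γ nabla S := by
  have hr := D.isRegularOn_γ hS h
  refine ⟨_, hr.isTorsionFreeConnectionOn, fun x hx X Z W hX hZ hW ↦ ?_⟩
  have h1 := (hr.isKoszulSolution hx hZ X hX).1 W hW
  have h2 := (hr.isKoszulSolution hx hW X hX).1 Z hZ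
  simp only [zero_apply, mul_zero, add_zero] at h1 h2
  rw [D.γ_symm] at h2
  simp only [covTwo, covVec, ← koszul_add_swap D.γ_symm, ← h1, ← h2]
  ring

lemma γ_sharp (h : D.IsNonNull x) (α : OneForm m N) (w : TangentSpace (𝓡 m) x) :
    D.γ x (D.sharp α x) w = α x w := by
  rw [sharp, dif_pos h]
  exact LinearMap.BilinForm.apply_toDual_symm_apply (hB := h.nondegenerate) (α x).toLinearMap w

lemma γ_ellSharp (h : D.IsNonNull x) (w : TangentSpace (𝓡 m) x) :
    D.γ x (D.ellSharp x) w = D.ell x w := D.γ_sharp h _ w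

lemma smoothVecAt_sharp (hS : IsOpen S) (h : ∀ x ∈ S, D.IsNonNull x) {α : OneForm m N}
    (hx : x ∈ S) (hα : SmoothFormAt α x) : SmoothVecAt (D.sharp α) x := by
  have hr := D.isRegularOn_γ hS h
  refine (smoothAt_of_nondegAt (c := fun _ ↦ 0) (hr.smoothTensor x hx) (hr.smoothForm x hx)
    (hr.smoothFun x hx) (hr.nondeg x hx) (fun W hW ↦ ?_) ?_).1
  · refine (hα.apply hW).congr_of_eventuallyEq ?_
    filter_upwards [hS.mem_nhds hx] with y hy
    simp [D.γ_sharp (h y hy)]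
  · simp only [zero_apply, zero_mul, add_zero]
    exact contMDiffAt_const

/-- Were the difference zero, `(ℓ♯, -1)` would lie in the radical of `𝒜`. -/
theorem ell2_sub_ellDotEll_ne_zero (h : D.IsNonNull x) : D.ell2 x - D.ellDotEll x ≠ 0 := by
  intro h0
  have := (D.nondegAt x (D.ellSharp x) (-1) (fun w ↦ by rw [D.γ_ellSharp h]; ring) ?_).2
  · norm_num at this
  · rw [← D.γ_ellSharp h, ← ellDotEll]
    linear_combination -h0

end MetricHypersurfaceData

end Existence

/-! ### The difference of the connections and comparison of their curvatures. -/

noncomputable section Curvature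

variable {m : ℕ} {N : Type*} [TopologicalSpace N] [ChartedSpace (EuclideanSpace ℝ (Fin m)) N]
  [IsManifold (𝓡 m) ∞ N]

namespace MetricHypersurfaceData

variable {D : MetricHypersurfaceData m N} {S : Set N} {x : N} {X Y Z W : VecField m N}
  {nablaO nablaG : ConnMap m N} {α : OneForm m N}

lemma U_swap : D.U X Y x = D.U Y X x := by
  simp only [U, lieDeriv, fun y ↦ D.γ_symm y (X y) (Y y), D.γ_symm x (X x),
    D.γ_symm x (bracket D.n X x)]
  ring

lemma smoothVecAt_covVec (hS : IsOpen S) (hG : IsTorsionFreeConnectionOn nablaG S)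
    (hZ : SmoothVecOn Z S) (hX : SmoothVecAt X x) (hx : x ∈ S) :
    SmoothVecAt (covVec nablaG X Z) x := by
  have h1 := hG.smooth.contMDiff (σ := Z) hZ
  exact ContMDiffAt.clm_bundle_apply (h1.contMDiffAt (hS.mem_nhds hx)) hX

lemma smoothVecOn_ellSharp (hS : IsOpen S) (h : ∀ x ∈ S, D.IsNonNull x) :
    SmoothVecOn D.ellSharp S :=
  fun _ hx ↦ (D.smoothVecAt_sharp hS h hx D.smoothFormAt_ell).contMDiffWithinAt

lemma diffVecAt_ellSharp (hS : IsOpen S) (h : ∀ x ∈ S, D.IsNonNull x) (hx : x ∈ S) :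
    DiffVecAt D.ellSharp x :=
  (D.smoothVecAt_sharp hS h hx D.smoothFormAt_ell).diffVecAt

/-- Lowering an index commutes with `∇` because `∇γ = 0`. The identity `γ(ℓ♯, ·) = ℓ` is
differentiated, so it is needed on a neighbourhood and not only at `x`. -/
lemma γ_nabla_ellSharp (hS : IsOpen S) (h : ∀ x ∈ S, D.IsNonNull x)
    (hG : IsLeviCivitaOn D.γ nablaG S) (hx : x ∈ S) (hX : DiffVecAt X x) (hW : DiffVecAt W x) :
    D.γ x (nablaG D.ellSharp x (X x)) (W x) = covForm nablaG D.ell X W x := by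
  have h1 := hG.metric x hx X D.ellSharp W hX (diffVecAt_ellSharp hS h hx) hW
  have h2 : dirDeriv X (fun y ↦ D.γ y (D.ellSharp y) (W y)) x =
      dirDeriv X (fun y ↦ D.ell y (W y)) x :=
    dirDeriv_congr ((hS.mem_nhds hx |> Filter.eventually_of_mem) fun y hy ↦ D.γ_ellSharp (h y hy) _)
  simp only [covTwo, h2, D.γ_ellSharp (h x hx)] at h1
  simp only [covForm]
  simp only [covVec] at h1 ⊢
  linear_combination -h1

/-- Writing the brackets through the torsion-free `∇`, the terms differentiating along `ℓ♯` cancel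
by `∇γ = 0`. The resulting expression depends only on the values of the fields at `x`, which makes
the tensoriality of `Π` usable below. -/
lemma deformation_eq (hS : IsOpen S) (h : ∀ x ∈ S, D.IsNonNull x)
    (hG : IsLeviCivitaOn D.γ nablaG S) (hx : x ∈ S) (hX : DiffVecAt X x) (hY : DiffVecAt Y x) :
    D.deformation X Y x = D.γ x (nablaG D.ellSharp x (X x)) (Y x) +
      D.γ x (nablaG D.ellSharp x (Y x)) (X x) := by
  have hl := diffVecAt_ellSharp hS h hx
  have h1 := hG.metric x hx D.ellSharp X Y hl hX hY
  simp only [covTwo] at h1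
  simp only [deformation, lieDeriv, ← hG.torsionFree x hx _ _ hl hX,
    ← hG.torsionFree x hx _ _ hl hY]
  simp only [covVec, map_sub, sub_apply] at h1 ⊢
  rw [D.γ_symm x (nablaG D.ellSharp x (Y x))]
  linear_combination h1

lemma extDerivForm_eq (hG : IsTorsionFreeConnectionOn nablaG S) (hx : x ∈ S) (hX : DiffVecAt X x)
    (hY : DiffVecAt Y x) :
    extDerivForm α X Y x = covForm nablaG α X Y x - covForm nablaG α Y X x := by
  simp only [extDerivForm, covForm, ← hG.torsionFree x hx _ _ hX hY, map_sub]
  ring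

lemma dirDeriv_ellDotEll (hS : IsOpen S) (h : ∀ x ∈ S, D.IsNonNull x)
    (hG : IsLeviCivitaOn D.γ nablaG S) (hx : x ∈ S) (hX : DiffVecAt X x) :
    dirDeriv X D.ellDotEll x = 2 * D.γ x (nablaG D.ellSharp x (X x)) (D.ellSharp x) := by
  have hl := diffVecAt_ellSharp hS h hx
  have h1 := hG.metric x hx X D.ellSharp D.ellSharp hX hl hl
  simp only [covTwo, covVec, D.γ_symm x (D.ellSharp x)] at h1
  have h2 : D.ellDotEll = fun y ↦ D.γ y (D.ellSharp y) (D.ellSharp y) := rfl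
  rw [h2]
  linear_combination h1

/-- The difference of the metric hypersurface connection and the Levi-Civita connection. -/
lemma nablaO_eq_add_U (h : ∀ x ∈ S, D.IsNonNull x)
    (hO : D.IsMetricHypersurfaceConnection nablaO) (hG : IsLeviCivitaOn D.γ nablaG S) (hx : x ∈ S)
    (hX : DiffVecAt X x) (hZ : DiffVecAt Z x) :
    nablaO Z x (X x) = nablaG Z x (X x) + D.U X Z x • D.ellSharp x := by
  -- The part of the difference not accounted for by `U ⊗ ℓ♯`, with its vector index lowered.
  let T : VecField m N → VecField m N → VecField m N → ℝ := fun X Z W ↦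
    D.γ x (nablaO Z x (X x) - nablaG Z x (X x)) (W x) - D.U X Z x * D.ell x (W x)
  have hanti : ∀ {X Z W : VecField m N}, DiffVecAt X x → DiffVecAt Z x → DiffVecAt W x →
      T X Z W = - T X W Z := by
    intro X Z W hX hZ hW
    have h1 := hO.deriv_γ x X Z W hX hZ hW
    have h2 := hG.metric x hx X Z W hX hZ hW
    simp only [covTwo, covVec, D.γ_symm x (Z x)] at h1 h2
    simp only [T, map_sub, sub_apply]
    linear_combination h2 - h1
  have hsymm : ∀ {X Z W : VecField m N}, DiffVecAt X x → DiffVecAt Z x → T X Z W = T Z X W := by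
    intro X Z W hX hZ
    have h1 := hO.torsionFree x trivial X Z hX hZ
    have h2 := hG.torsionFree x hx X Z hX hZ
    have h3 : nablaO Z x (X x) - nablaG Z x (X x) = nablaO X x (Z x) - nablaG X x (Z x) := by
      rw [sub_eq_sub_iff_sub_eq_sub]
      exact h1.trans h2.symm
    simp only [T, h3, D.U_swap (X := X)]
  have hT : ∀ W : VecField m N, DiffVecAt W x → T X Z W = 0 := by
    intro W hW
    -- Alternating the two symmetries six times returns to `T X Z W` with three sign changes, so it
    -- equals its own negative.
    linarith [hanti hX hZ hW, hsymm (W := Z) hX hW, hanti hW hX hZ, hsymm (W := X) hW hZ,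
      hanti hZ hW hX, hsymm (W := W) hZ hX]
  have hv : nablaO Z x (X x) - nablaG Z x (X x) - D.U X Z x • D.ellSharp x = 0 := by
    refine h x hx _ fun w ↦ ?_
    obtain ⟨W, hW, rfl⟩ := exists_diffVecAt w
    simpa [T, D.γ_ellSharp (h x hx)] using hT W hW
  rw [← sub_eq_zero, ← sub_sub]
  exact hv

/-- Each `∇ℓ` in the defining equation for `ℓ` changes by `-(ℓ·ℓ) U` when passing to Levi-Civita, so
the equation reads `Π - 2 (ℓ·ℓ) U = -2 ℓ⁽²⁾ U`. -/
lemma U_eq (hS : IsOpen S) (h : ∀ x ∈ S, D.IsNonNull x)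
    (hO : D.IsMetricHypersurfaceConnection nablaO) (hG : IsLeviCivitaOn D.γ nablaG S) (hx : x ∈ S)
    (hX : DiffVecAt X x) (hZ : DiffVecAt Z x) : D.U X Z x = D.f x * D.deformation X Z x := by
  have h1 := hO.deriv_ell x X Z hX hZ
  have h2 := nablaO_eq_add_U h hO hG hx hX hZ
  have h3 := nablaO_eq_add_U h hO hG hx hZ hX
  have h4 := deformation_eq hS h hG hx hX hZ
  rw [γ_nabla_ellSharp hS h hG hx hX hZ, γ_nabla_ellSharp hS h hG hx hZ hX] at h4
  have h5 : D.ell x (D.ellSharp x) = D.ellDotEll x := (D.γ_ellSharp (h x hx) _).symm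
  simp only [covForm, covVec, h2, h3, map_add, map_smul, D.U_swap (X := Z), smul_eq_mul, h5]
    at h1 h4
  have h6 := D.ell2_sub_ellDotEll_ne_zero (h x hx)
  rw [f]
  field_simp
  linear_combination h1 + h4

lemma nablaO_eq_add (hS : IsOpen S) (h : ∀ x ∈ S, D.IsNonNull x)
    (hO : D.IsMetricHypersurfaceConnection nablaO) (hG : IsLeviCivitaOn D.γ nablaG S) (hx : x ∈ S)
    (hX : DiffVecAt X x) (hZ : DiffVecAt Z x) :
    nablaO Z x (X x) = nablaG Z x (X x) + (D.f x * D.deformation X Z x) • D.ellSharp x := by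
  rw [nablaO_eq_add_U h hO hG hx hX hZ, U_eq hS h hO hG hx hX hZ]

lemma mdifferentiableAt_f (hS : IsOpen S) (h : ∀ x ∈ S, D.IsNonNull x) (hx : x ∈ S) :
    MDifferentiableAt (𝓡 m) 𝓘(ℝ, ℝ) D.f x := by
  have hl := diffVecAt_ellSharp hS h hx
  have h1 : MDifferentiableAt (𝓡 m) 𝓘(ℝ, ℝ) D.ellDotEll x :=
    D.smoothTwoTensorAt_γ.mdifferentiableAt_apply hl hl
  have h2 : MDifferentiableAt (𝓡 m) 𝓘(ℝ, ℝ) D.ell2 x :=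
    (D.ell2_smooth x).mdifferentiableAt (by simp)
  have h3 := D.ell2_sub_ellDotEll_ne_zero (h x hx)
  have h4 : DifferentiableAt ℝ (fun t : ℝ ↦ -1 / (2 * t)) (D.ell2 x - D.ellDotEll x) := by
    fun_prop (disch := simpa using h3)
  exact MDifferentiableAt.comp (f := fun y ↦ D.ell2 y - D.ellDotEll y)
    (g := fun t : ℝ ↦ -1 / (2 * t)) x h4.mdifferentiableAt (h2.sub h1)

lemma mdifferentiableAt_deformation (hS : IsOpen S) (h : ∀ x ∈ S, D.IsNonNull x)
    (hG : IsLeviCivitaOn D.γ nablaG S) (hx : x ∈ S) (hX : SmoothVecAt X x) (hY : SmoothVecAt Y x) :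
    MDifferentiableAt (𝓡 m) 𝓘(ℝ, ℝ) (D.deformation X Y) x := by
  have hl := smoothVecOn_ellSharp hS h
  have h1 := smoothVecAt_covVec hS hG.toIsTorsionFreeConnectionOn hl hX hx
  have h2 := smoothVecAt_covVec hS hG.toIsTorsionFreeConnectionOn hl hY hx
  refine ((D.smoothTwoTensorAt_γ.mdifferentiableAt_apply h1.diffVecAt hY.diffVecAt).add
    (D.smoothTwoTensorAt_γ.mdifferentiableAt_apply h2.diffVecAt
      hX.diffVecAt)).congr_of_eventuallyEq ?_
  filter_upwards [hS.mem_nhds hx, hX.eventually_diffVecAt, hY.eventually_diffVecAt]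
    with y hy hXy hYy
  exact deformation_eq hS h hG hy hXy hYy

lemma covVec_nablaO_covVec_nablaO (hS : IsOpen S) (h : ∀ x ∈ S, D.IsNonNull x)
    (hO : D.IsMetricHypersurfaceConnection nablaO) (hG : IsLeviCivitaOn D.γ nablaG S) (hx : x ∈ S)
    (hX : SmoothVecAt X x) (hY : SmoothVecAt Y x) (hZ : SmoothVecOn Z S) :
    covVec nablaO X (covVec nablaO Y Z) x = covVec nablaG X (covVec nablaG Y Z) x +
      (D.f x * D.deformation Y Z x) • nablaG D.ellSharp x (X x) +
      (D.f x * dirDeriv X (D.deformation Y Z) x + dirDeriv X D.f x * D.deformation Y Z x +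
        D.f x * D.deformation X (covVec nablaG Y Z) x +
        D.f x ^ 2 * D.deformation Y Z x * D.deformation X D.ellSharp x) • D.ellSharp x := by
  have hl := smoothVecOn_ellSharp hS h
  have hlx := diffVecAt_ellSharp hS h hx
  have hZx := hZ.smoothVecAt hS hx
  have hYZ := (smoothVecAt_covVec hS hG.toIsTorsionFreeConnectionOn hZ hY hx).diffVecAt
  have hf := mdifferentiableAt_f hS h hx
  have hP := mdifferentiableAt_deformation hS h hG hx hY hZx
  have hfP : MDifferentiableAt (𝓡 m) 𝓘(ℝ, ℝ) (fun y ↦ D.f y * D.deformation Y Z y) x := hf.mul hP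
  have hsm := hlx.smul hfP
  have hV := hYZ.add hsm
  -- The inner derivative is replaced on a neighbourhood, so that locality of the connection allows
  -- the outer derivative to be taken of the replacement.
  have hev : ∀ᶠ y in nhds x, covVec nablaO Y Z y =
      (covVec nablaG Y Z + (fun y ↦ D.f y * D.deformation Y Z y) • D.ellSharp) y := by
    filter_upwards [hS.mem_nhds hx, hY.eventually_diffVecAt] with y hy hYy
    exact nablaO_eq_add hS h hO hG hy hYy (hZ.smoothVecAt hS hy).diffVecAt
  have h1 : covVec nablaO X (covVec nablaO Y Z) x = covVec nablaO X
      (covVec nablaG Y Z + (fun y ↦ D.f y * D.deformation Y Z y) • D.ellSharp) x :=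
    congrArg (fun A ↦ A (X x)) (hO.isCovariantDerivativeOn.congr_of_eventuallyEq (hV.congr hev) hV
      Filter.univ_mem hev)
  -- The difference formula is applied again to the expanded field: its `Π` term against `f Π(Y, Z)
  -- ℓ♯` produces the `f²` contribution.
  have h2 := nablaO_eq_add hS h hO hG hx hX.diffVecAt hV
  rw [deformation_eq hS h hG hx hX.diffVecAt hV,
    hG.isCovariantDerivativeOn.add hYZ hsm hx, hG.isCovariantDerivativeOn.leibniz hlx hfP hx] at h2
  have h3 : mvfderiv (𝓡 m) (fun y ↦ D.f y * D.deformation Y Z y) x (X x) =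
    D.f x * dirDeriv X (D.deformation Y Z) x + dirDeriv X D.f x * D.deformation Y Z x :=
    dirDeriv_mul hf hP
  rw [h1, covVec, h2, deformation_eq hS h hG hx hX.diffVecAt hYZ,
    deformation_eq hS h hG hx hX.diffVecAt hlx]
  simp only [Pi.add_apply, Pi.smul_apply', map_add, map_smul, add_apply, smul_apply,
    ContinuousLinearMap.smulRight_apply, h3, smul_eq_mul]
  simp only [covVec]
  module

theorem deformation_eq_covForm (hS : IsOpen S) (h : ∀ x ∈ S, D.IsNonNull x)
    (hG : IsLeviCivitaOn D.γ nablaG S) (hx : x ∈ S) (hX : DiffVecAt X x) (hY : DiffVecAt Y x) :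
    D.deformation X Y x = covForm nablaG D.ell X Y x + covForm nablaG D.ell Y X x := by
  rw [deformation_eq hS h hG hx hX hY, γ_nabla_ellSharp hS h hG hx hX hY,
    γ_nabla_ellSharp hS h hG hx hY hX]

/-- The relation between the curvatures of the metric hypersurface connection and of the
Levi-Civita connection. -/
theorem riem_eq (hS : IsOpen S) (h : ∀ x ∈ S, D.IsNonNull x)
    (hO : D.IsMetricHypersurfaceConnection nablaO) (hG : IsLeviCivitaOn D.γ nablaG S)
    (hα : SmoothFormOn α S) (hZ : SmoothVecOn Z S) (hX : SmoothVecOn X S) (hY : SmoothVecOn Y S)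
    (hx : x ∈ S) :
    riem nablaO α Z X Y x = riem nablaG α Z X Y x
      + α x (D.ellSharp x) *
        ((D.f x * covTwo nablaG D.deformation X Z Y x
            + D.deformation Z Y x * (dirDeriv X D.f x
              + 1 / 2 * D.f x ^ 2 * dirDeriv X D.ellDotEll x
              + D.f x ^ 2 * D.accelForm nablaG X x))
          - (D.f x * covTwo nablaG D.deformation Y Z X x
            + D.deformation Z X x * (dirDeriv Y D.f x
              + 1 / 2 * D.f x ^ 2 * dirDeriv Y D.ellDotEll x
              + D.f x ^ 2 * D.accelForm nablaG Y x)))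
      + D.f x / 2 * (D.deformation (D.sharp α) X x * D.deformation Z Y x
          - D.deformation (D.sharp α) Y x * D.deformation Z X x)
      + D.f x * (D.F (D.sharp α) Y x * D.deformation Z X x
          - D.F (D.sharp α) X x * D.deformation Z Y x) := by
  have hXx := hX.smoothVecAt hS hx
  have hYx := hY.smoothVecAt hS hx
  have hZx := hZ.smoothVecAt hS hx
  have hA := (D.smoothVecAt_sharp hS h hx (hα.smoothFormAt hS hx)).diffVecAt
  have hl := diffVecAt_ellSharp hS h hx
  have hB := (hXx.bracket hYx).diffVecAt
  have hT := hG.toIsTorsionFreeConnectionOn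
  have hcov : ∀ {V W : VecField m N}, SmoothVecOn V S → SmoothVecAt W x →
      DiffVecAt (covVec nablaG W V) x := fun hV hW ↦ (smoothVecAt_covVec hS hT hV hW hx).diffVecAt
  have hdef : ∀ {V W : VecField m N}, DiffVecAt V x → DiffVecAt W x → D.deformation V W x =
      D.γ x (nablaG D.ellSharp x (V x)) (W x) + D.γ x (nablaG D.ellSharp x (W x)) (V x) :=
    fun hV hW ↦ deformation_eq hS h hG hx hV hW
  -- The expansion differentiates `Π(Y, Z)`, while the claim has `Π(Z, Y)`; symmetry is needed near
  -- `x` to compare the derivatives.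
  have hdsymm : ∀ {V W : VecField m N}, SmoothVecAt V x → SmoothVecAt W x → ∀ U : VecField m N,
      dirDeriv U (D.deformation V W) x = dirDeriv U (D.deformation W V) x := by
    intro V W hV hW U
    refine dirDeriv_congr ?_
    filter_upwards [hS.mem_nhds hx, hV.eventually_diffVecAt, hW.eventually_diffVecAt]
      with y hy hVy hWy
    rw [deformation_eq hS h hG hy hVy hWy, deformation_eq hS h hG hy hWy hVy, add_comm]
  have hF : ∀ {V W : VecField m N}, DiffVecAt V x → DiffVecAt W x → D.F V W x = 1 / 2 *
      (D.γ x (nablaG D.ellSharp x (V x)) (W x) - D.γ x (nablaG D.ellSharp x (W x)) (V x)) := by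
    intro V W hV hW
    rw [F, extDerivForm_eq hT hx hV hW, γ_nabla_ellSharp hS h hG hx hV hW,
      γ_nabla_ellSharp hS h hG hx hW hV]
  -- Pairing `α` with `∇_X ℓ♯` becomes `γ(∇_X ℓ♯, α♯)`, whose symmetric and antisymmetric parts are
  -- the terms with `Π` and `F`.
  have hαγ : ∀ v, α x v = D.γ x v (D.sharp α x) := fun v ↦ by
    rw [D.γ_symm, D.γ_sharp (h x hx)]
  have hbr : bracket X Y x = nablaG Y x (X x) - nablaG X x (Y x) :=
    (hG.torsionFree x hx X Y hXx.diffVecAt hYx.diffVecAt).symm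
  simp only [riem, curvature]
  rw [covVec_nablaO_covVec_nablaO hS h hO hG hx hXx hYx hZ,
    covVec_nablaO_covVec_nablaO hS h hO hG hx hYx hXx hZ]
  have h3 : covVec nablaO (bracket X Y) Z x = _ :=
    nablaO_eq_add hS h hO hG hx hB hZx.diffVecAt
  rw [h3, dirDeriv_ellDotEll hS h hG hx hXx.diffVecAt, dirDeriv_ellDotEll hS h hG hx hYx.diffVecAt,
    hdsymm hYx hZx, hdsymm hXx hZx, accelForm, accelForm, hF hA hXx.diffVecAt, hF hA hYx.diffVecAt,
    hdef hA hXx.diffVecAt, hdef hA hYx.diffVecAt]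
  simp only [covTwo]
  rw [hdef hYx.diffVecAt hZx.diffVecAt, hdef hXx.diffVecAt hZx.diffVecAt,
    hdef hZx.diffVecAt hYx.diffVecAt, hdef hZx.diffVecAt hXx.diffVecAt,
    hdef hXx.diffVecAt (hcov hZ hYx), hdef hYx.diffVecAt (hcov hZ hXx),
    hdef hXx.diffVecAt hl, hdef hYx.diffVecAt hl, hdef (hcov hZ hXx) hYx.diffVecAt,
    hdef (hcov hZ hYx) hXx.diffVecAt, hdef hZx.diffVecAt (hcov hY hXx),
    hdef hZx.diffVecAt (hcov hX hYx), hdef hB hZx.diffVecAt]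
  -- The terms with `Π` and `F` now read as pairings `γ(∇ℓ♯, ·)`, and the bracket is a difference of
  -- derivatives, so what is left is a polynomial identity.
  simp only [covVec, hbr, map_add, map_sub, map_smul, smul_eq_mul, sub_apply,
    hαγ (nablaG D.ellSharp x (X x)), hαγ (nablaG D.ellSharp x (Y x))]
  ring

end MetricHypersurfaceData

end Curvature

end HypersurfaceData

/-! ### Assembly of existence, regularity and the curvature formula. -/

theorem mainTheorem12 {m : ℕ} {N : Type*} [TopologicalSpace N] [T2Space N]
    [ChartedSpace (EuclideanSpace ℝ (Fin m)) N] [IsManifold (𝓡 m) ∞ N]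
    (D : HypersurfaceData.MetricHypersurfaceData m N)
    (p : N) (Up : Set N) (hUp_open : IsOpen Up) (hp : p ∈ Up)
    (hUp : ∀ x ∈ Up, D.IsNonNull x) :
    (∃ nablaO : HypersurfaceData.ConnMap m N, D.IsMetricHypersurfaceConnection nablaO) ∧
    (∃ nablaG : HypersurfaceData.ConnMap m N, HypersurfaceData.IsLeviCivitaOn D.γ nablaG Up) ∧
    (∀ x ∈ Up, D.ell2 x - D.ellDotEll x ≠ 0) ∧
    ∀ nablaO nablaG : HypersurfaceData.ConnMap m N,
      D.IsMetricHypersurfaceConnection nablaO →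
      HypersurfaceData.IsLeviCivitaOn D.γ nablaG Up →
      (∀ X Y : HypersurfaceData.VecField m N,
        HypersurfaceData.SmoothVecOn X Up → HypersurfaceData.SmoothVecOn Y Up →
        ∀ x ∈ Up, D.deformation X Y x =
          HypersurfaceData.covForm nablaG D.ell X Y x
            + HypersurfaceData.covForm nablaG D.ell Y X x) ∧
      ∀ (α : HypersurfaceData.OneForm m N) (Z X Y : HypersurfaceData.VecField m N),
        HypersurfaceData.SmoothFormOn α Up → HypersurfaceData.SmoothVecOn Z Up →
        HypersurfaceData.SmoothVecOn X Up → HypersurfaceData.SmoothVecOn Y Up →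
        ∀ x ∈ Up,
          HypersurfaceData.riem nablaO α Z X Y x =
            HypersurfaceData.riem nablaG α Z X Y x
            + α x (D.ellSharp x) *
              ((D.f x * HypersurfaceData.covTwo nablaG D.deformation X Z Y x
                  + D.deformation Z Y x *
                    (HypersurfaceData.dirDeriv X D.f x
                      + 1 / 2 * D.f x ^ 2 * HypersurfaceData.dirDeriv X D.ellDotEll x
                      + D.f x ^ 2 * D.accelForm nablaG X x))
                - (D.f x * HypersurfaceData.covTwo nablaG D.deformation Y Z X x
                  + D.deformation Z X x *
                    (HypersurfaceData.dirDeriv Y D.f x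
                      + 1 / 2 * D.f x ^ 2 * HypersurfaceData.dirDeriv Y D.ellDotEll x
                      + D.f x ^ 2 * D.accelForm nablaG Y x)))
            + D.f x / 2 *
              (D.deformation (D.sharp α) X x * D.deformation Z Y x
                - D.deformation (D.sharp α) Y x * D.deformation Z X x)
            + D.f x *
              (D.F (D.sharp α) Y x * D.deformation Z X x
                - D.F (D.sharp α) X x * D.deformation Z Y x) := by
  refine ⟨D.exists_isMetricHypersurfaceConnection, D.exists_isLeviCivitaOn hUp_open hUp,
    fun x hx ↦ D.ell2_sub_ellDotEll_ne_zero (hUp x hx), fun nablaO nablaG hO hG ↦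
    ⟨fun X Y hX hY x hx ↦ ?_, fun α Z X Y hα hZ hX hY x hx ↦ ?_⟩⟩
  · exact HypersurfaceData.MetricHypersurfaceData.deformation_eq_covForm hUp_open hUp hG hx
      (hX.smoothVecAt hUp_open hx).diffVecAt (hY.smoothVecAt hUp_open hx).diffVecAt
  · exact HypersurfaceData.MetricHypersurfaceData.riem_eq hUp_open hUp hO hG hα hZ hX hY hx
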